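/- Let $d$ be a natural number and $\lambda>0$. Equip $\mathbb Z^d$ with the nearest-neighbour graph structure ($u\sim v$ iff $\|u-v\|_1=1$). For a finite graph $G$ put $Z_G=\sum_M\lambda^{|M|}$, the sum being over all matchings $M$ of $G$. A Gibbs measure of the monomer-dimer model with activity $\lambda$ on a graph $G=(V,E)$ is a probability measure on $\{0,1\}^E$ (identified with the law of a random set of edges $\mathbf M\subseteq E$, with the product $\sigma$-field) such that for every finite $F\subset E$ and $S\subseteq F$, the conditional probability of $\mathbf M\cap F=S$ given $\mathbf M\setminus F$ is almost surely $\lambda^{|S|}\big/\sum_T\lambda^{|T|}$ if $S$ is a matching none of whose edges shares a node with an edge of $\mathbf M\setminus F$, and $0$ otherwise; here $T$ ranges over all matchings $T\subseteq F$ none of whose edges shares a node with an edge of $\mathbf M\setminus F$. Write $0\notin\mathbf M$ for the event that no edge of $\mathbf M$ is incident to the origin. For $v,u\in\mathbb Z^d$ write $v\prec u$ iff there is $k$ with $v_k<u_k$ and $v_j=u_j$ for all $j>k$, and let $$\mathbb Z^d_{\prec0}=\{u:u\prec0\}\cup\{0\},\qquad \mathbb Z^d_{\prec0,\mathrm{even}}=\mathbb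 Z^d_{\prec0}\cup\Big\{u:0\prec u,\ \sum_i u_i\text{ odd}\Big\}.$$ Then on each of the subgraphs of $\mathbb Z^d$ induced by $\mathbb Z^d_{\prec0}$ and $\mathbb Z^d_{\prec0,\mathrm{even}}$ there is exactly one Gibbs measure, denoted $\mathbb P_{\mathbb Z^d_{\prec0}}$ and $\mathbb P_{\mathbb Z^d_{\prec0,\mathrm{even}}}$ respectively; the event $0\notin\mathbf M$ has positive probability under both; and the free energy $$\mathcal P(d,\lambda)=\lim_{n\to\infty}\frac{\log Z_{\Lambda_n}}{|\Lambda_n|}$$ exists and takes the same value for all sequences of finite sets $0\in\Lambda_0\subseteq\Lambda_1\subseteq\cdots\subset\mathbb Z^d$ such that every ball $\{v:\|v\|_1\le r\}$ is contained in $\Lambda_n$ for all large $n$ and $|\partial\Lambda_n|/|\Lambda_n|\to0$, where $Z_{\Lambda_n}$ is the partition function of the subgraph induced by $\Lambda_n$ and $\partial\Lambda_n=\{v\in\Lambda_n: v\text{ has a neighbour outside }\Lambda_n\}$. Moreover $$\mathcal P(d,\lambda)=-\log\mathbb P_{\mathbb Z^d_{\prec0}}(0\notin\mathbf M)=-\tfrac12\log\mathbb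 P_{\mathbb Z^d_{\prec0,\mathrm{even}}}(0\notin\mathbf M).$$ -/

import Mathlib

open Filter Topology MeasureTheory ProbabilityTheory

namespace MonomerDimer

/-! ### The lattice, the lexicographic order and the two cavity regions -/

/-- The `ℓ¹` norm on `ℤ^d`. -/
def l1norm {d : ℕ} (v : Fin d → ℤ) : ℤ := ∑ j, |v j|

/-- The lattice `ℤ^d`: `u` and `v` are adjacent iff `‖v - u‖₁ = 1`. -/
def lattice (d : ℕ) : SimpleGraph (Fin d → ℤ) where
  Adj u v := l1norm (v - u) = 1
  symm := ⟨fun u v h => by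
    simpa only [l1norm, Pi.sub_apply, abs_sub_comm] using h⟩
  loopless := ⟨fun v h => by simp [l1norm] at h⟩

/-- The lexicographic order on `ℤ^d`, the last coordinate being the most significant one:
`v ≺ u` iff for some `k` one has `v k < u k` and `v j = u j` for all `j > k`. -/
def Prec {d : ℕ} (v u : Fin d → ℤ) : Prop :=
  ∃ k : Fin d, v k < u k ∧ ∀ j : Fin d, k < j → v j = u j

/-- `ℤ^d_{≺0} = {u : u ≺ 0} ∪ {0}`. -/
def below (d : ℕ) : Set (Fin d → ℤ) := {u | Prec u 0} ∪ {0}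

/-- `ℤ^d_{≺0,even} = ℤ^d_{≺0} ∪ {u : 0 ≺ u and the sum of the coordinates of u is odd}`. -/
def belowEven (d : ℕ) : Set (Fin d → ℤ) := below d ∪ {u | Odd (∑ j, u j) ∧ Prec 0 u}

/-- The origin belongs to `ℤ^d_{≺0}`. -/
theorem zero_mem_below (d : ℕ) : (0 : Fin d → ℤ) ∈ below d := Or.inr rfl

/-- The origin belongs to `ℤ^d_{≺0,even}`. -/
theorem zero_mem_belowEven (d : ℕ) : (0 : Fin d → ℤ) ∈ belowEven d := Or.inl (zero_mem_below d)

/-! ### Matchings and the partition function of a finite graph -/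

/-- A set of edges of `G` is a matching if no two (distinct) edges in it share a node. Two edges
are adjacent in the line graph of `G` iff they are distinct and share a node. -/
def IsMatching {V : Type*} (G : SimpleGraph V) (M : Set G.edgeSet) : Prop :=
  ∀ e ∈ M, ∀ e' ∈ M, ¬ G.lineGraph.Adj e e'

open Classical in
/-- The partition function `Z_G = ∑_M λ^|M|` of a finite graph `G`, the sum being over all
matchings `M` of `G`. -/
noncomputable def partitionFunction {V : Type*} [Finite V] (G : SimpleGraph V) (lam : ℝ) : ℝ :=
  letI : Fintype G.edgeSet := Fintype.ofFinite _
  ∑ M : Finset G.edgeSet, if IsMatching G (M : Set G.edgeSet) then lam ^ M.card else 0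

/-! ### Gibbs measures on a (possibly infinite) graph -/

/-- Spin configurations: `σ e = true` means that the edge `e` belongs to the random matching `𝐌`
(spin `1`) and `σ e = false` that it does not (spin `0`). The space carries the product
`σ`-field. -/
abbrev Config {V : Type*} (G : SimpleGraph V) : Type _ := G.edgeSet → Bool

/-- The configuration which inside the finite set `F` of edges is given by `S ⊆ F` and outside `F`
by `σ` violates no hard-core constraint that involves an edge of `F`. -/
def Compatible {V : Type*} (G : SimpleGraph V) (F S : Finset G.edgeSet) (σ : Config G) : Prop :=
  IsMatching G (S : Set G.edgeSet) ∧
    ∀ e ∈ S, ∀ e' : G.edgeSet, e' ∉ F → σ e' = true → ¬ G.lineGraph.Adj e e'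

open Classical in
/-- The weight of `S ⊆ F` under the boundary condition `σ` outside `F`. -/
noncomputable def weight {V : Type*} (G : SimpleGraph V) (lam : ℝ) (F S : Finset G.edgeSet)
    (σ : Config G) : ℝ :=
  if Compatible G F S σ then lam ^ S.card else 0

/-- The finite-volume Gibbs distribution on the subsets `S` of the finite set `F` of edges, under
the boundary condition `σ` outside `F`. The denominator is at least `1` (take `T = ∅`). -/
noncomputable def finiteGibbs {V : Type*} (G : SimpleGraph V) (lam : ℝ) (F S : Finset G.edgeSet)
    (σ : Config G) : ℝ :=
  weight G lam F S σ / ∑ T ∈ F.powerset, weight G lam F T σ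

/-- `μ` is a Gibbs measure of the monomer-dimer model with activity `lam` on `G`: a probability
measure such that for every finite set `F` of edges the conditional distribution of the
configuration in `F`, given the configuration outside `F`, is the finite-volume Gibbs
distribution (spatial Markovian property). -/
structure IsGibbsMeasure {V : Type*} (G : SimpleGraph V) (lam : ℝ) (μ : Measure (Config G)) :
    Prop where
  isProbabilityMeasure : IsProbabilityMeasure μ
  condProb : ∀ F S : Finset G.edgeSet, S ⊆ F →
    μ⟦{σ : Config G | ∀ e ∈ F, (σ e = true ↔ e ∈ S)} | cylinderEvents (F : Set G.edgeSet)ᶜ⟧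
      =ᵐ[μ] fun σ => finiteGibbs G lam F S σ

/-- The event `v ∉ 𝐌`: the random matching contains no edge incident to the node `v`. -/
def unmatched {V : Type*} (G : SimpleGraph V) (v : V) : Set (Config G) :=
  {σ | ∀ e : G.edgeSet, v ∈ (e : Sym2 V) → σ e = false}

/-! ### The free energy -/

/-- The boundary `∂Λ = {v ∈ Λ : N(v) ∩ Λᶜ ≠ ∅}` of a finite subset `Λ` of the lattice. -/
def boundary {d : ℕ} (Λ : Finset (Fin d → ℤ)) : Set (Fin d → ℤ) :=
  {v | v ∈ Λ ∧ ∃ u, (lattice d).Adj v u ∧ u ∉ Λ}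

/-- Admissible sequences of finite regions: `0 ∈ Λ₀ ⊆ Λ₁ ⊆ ⋯`, every ball around the origin is
eventually contained in `Λₙ`, and `|∂Λₙ| / |Λₙ| → 0`. -/
structure IsExhaustion {d : ℕ} (Λ : ℕ → Finset (Fin d → ℤ)) : Prop where
  zero_mem : 0 ∈ Λ 0
  mono : Monotone Λ
  ball_subset : ∀ r : ℕ, ∀ᶠ n in atTop, ∀ v : Fin d → ℤ, l1norm v ≤ r → v ∈ Λ n
  boundary_small : Tendsto (fun n => ((boundary (Λ n)).ncard : ℝ) / (Λ n).card) atTop (𝓝 0)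

/-- `P` is the free energy (pressure) of the monomer-dimer model on `ℤ^d` with activity `lam`:
`log Z_{Λₙ} / |Λₙ|` converges to `P` along every admissible sequence of finite regions, where
`Z_{Λₙ}` is the partition function of the subgraph of the lattice induced by `Λₙ`. -/
def IsFreeEnergy (d : ℕ) (lam P : ℝ) : Prop :=
  ∀ Λ : ℕ → Finset (Fin d → ℤ), IsExhaustion Λ →
    Tendsto (fun n =>
      Real.log (partitionFunction ((lattice d).induce (Λ n : Set (Fin d → ℤ))) lam) / (Λ n).card)
      atTop (𝓝 P)

end MonomerDimer

/-!
Write `ρ` for the probability that the node `v` is unmatched in a finite-volume model. Conditioning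
on the edge at `v` gives the cavity recursion `ρ = 1 / (1 + lam * ∑ ρᵢ)`, in which `ρᵢ` is the same
probability for a neighbour of `v` once `v` is deleted. If the `ρᵢ` change by factors at most
`1 + δ`, then `ρ` changes by a factor at most `1 + δ * K / (1 + K)`, where `K` is `lam` times the
maximal degree, so correlations decay exponentially. Hence there is exactly one Gibbs measure, and
its vacancy probabilities are limits of finite-volume ones.

Deleting the nodes of `Λₙ` in decreasing lexicographic order writes `-log Z_{Λₙ}` as the sum of the
logarithms of the vacancy probabilities of the deleted nodes. Seen from a node `v` far from the
boundary, the remaining graph looks like `ℤ^d_{≺0}`, and since `|∂Λₙ| / |Λₙ| → 0` the average of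
these logarithms converges to the value at the origin. If only nodes with even coordinate sum are
deleted, half of the nodes are, the remaining graph looks like `ℤ^d_{≺0,even}`, and what is left in
the end is edgeless because the lattice is bipartite.
-/

namespace MonomerDimer

section MatchingSum

variable {V : Type*} {G : SimpleGraph V} {lam : ℝ}

theorem isMatching_empty : IsMatching G ∅ := fun _ h => h.elim

theorem IsMatching.mono {S T : Set G.edgeSet} (h : IsMatching G T) (hST : S ⊆ T) :
    IsMatching G S := fun e he e' he' => h e (hST he) e' (hST he')

theorem isMatching_union {S T : Set G.edgeSet} :
    IsMatching G (S ∪ T) ↔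
      IsMatching G S ∧ IsMatching G T ∧ ∀ e ∈ S, ∀ e' ∈ T, ¬ G.lineGraph.Adj e e' := by
  refine ⟨fun h => ⟨h.mono Set.subset_union_left, h.mono Set.subset_union_right,
    fun e he e' he' => h e (Or.inl he) e' (Or.inr he')⟩, ?_⟩
  rintro ⟨hS, hT, hST⟩ e (he | he) e' (he' | he')
  · exact hS e he e' he'
  · exact hST e he e' he'
  · exact fun hadj => hST e' he' e he hadj.symm
  · exact hT e he e' he'

open Classical in
/-- The weight of a set of edges in the partition function: `λ^|S|` if `S` is a matching, and `0`
otherwise. -/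
noncomputable def matchingWeight (G : SimpleGraph V) (lam : ℝ) (S : Finset G.edgeSet) : ℝ :=
  if IsMatching G (S : Set G.edgeSet) then lam ^ S.card else 0

/-- The partition function of a finite set `F` of edges: the sum of `λ^|S|` over all matchings
`S ⊆ F`. -/
noncomputable def matchingSum (G : SimpleGraph V) (lam : ℝ) (F : Finset G.edgeSet) : ℝ :=
  ∑ S ∈ F.powerset, matchingWeight G lam S

open Classical in
/-- The edges of the finite set `F` that do not belong to `A`. -/
noncomputable def deleteEdges (F : Finset G.edgeSet) (A : Set G.edgeSet) : Finset G.edgeSet :=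
  F.filter fun e => e ∉ A

/-- The edges incident to the node `v`. -/
def edgesAt (G : SimpleGraph V) (v : V) : Set G.edgeSet := {e | v ∈ (e : Sym2 V)}

/-- The edges that share a node with `e`, including `e` itself. -/
def edgesMeeting (e : G.edgeSet) : Set G.edgeSet := {e' | ∃ v ∈ (e : Sym2 V), v ∈ (e' : Sym2 V)}

theorem matchingWeight_nonneg (hlam : 0 ≤ lam) (S : Finset G.edgeSet) :
    0 ≤ matchingWeight G lam S := by
  unfold matchingWeight
  split_ifs <;> positivity

theorem matchingSum_empty : matchingSum G lam ∅ = 1 := by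
  simp [matchingSum, matchingWeight, isMatching_empty]

theorem matchingSum_mono (hlam : 0 ≤ lam) : Monotone (matchingSum G lam) := fun _ _ h =>
  Finset.sum_le_sum_of_subset_of_nonneg (Finset.powerset_mono.2 h)
    fun S _ _ => matchingWeight_nonneg hlam S

theorem one_le_matchingSum (hlam : 0 ≤ lam) (F : Finset G.edgeSet) : 1 ≤ matchingSum G lam F :=
  matchingSum_empty.symm.trans_le (matchingSum_mono hlam (Finset.empty_subset F))

theorem matchingSum_pos (hlam : 0 ≤ lam) (F : Finset G.edgeSet) : 0 < matchingSum G lam F :=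
  one_pos.trans_le (one_le_matchingSum hlam F)

theorem mem_deleteEdges {F : Finset G.edgeSet} {A : Set G.edgeSet} {e : G.edgeSet} :
    e ∈ deleteEdges F A ↔ e ∈ F ∧ e ∉ A := by
  classical exact Finset.mem_filter

theorem deleteEdges_subset (F : Finset G.edgeSet) (A : Set G.edgeSet) : deleteEdges F A ⊆ F :=
  fun _ he => (mem_deleteEdges.1 he).1

theorem deleteEdges_deleteEdges (F : Finset G.edgeSet) (A B : Set G.edgeSet) :
    deleteEdges (deleteEdges F A) B = deleteEdges F (A ∪ B) := by
  ext e
  simp only [mem_deleteEdges, Set.mem_union, not_or, and_assoc]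

theorem deleteEdges_empty (F : Finset G.edgeSet) : deleteEdges F ∅ = F := by
  ext e
  simp only [mem_deleteEdges, Set.mem_empty_iff_false, not_false_eq_true, and_true]

theorem mem_edgesMeeting_self (e : G.edgeSet) : e ∈ edgesMeeting e :=
  (e : Sym2 V).ind (f := fun s => ∃ v ∈ s, v ∈ s)
    fun u v => ⟨u, Sym2.mem_mk_left u v, Sym2.mem_mk_left u v⟩

theorem edgesMeeting_eq_union {e : G.edgeSet} {u v : V} (h : (e : Sym2 V) = s(u, v)) :
    edgesMeeting e = edgesAt G u ∪ edgesAt G v := by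
  ext e'
  simp [edgesMeeting, edgesAt, h]

theorem exists_eq_mk_of_mem_edgesAt {e : G.edgeSet} {v : V} (h : e ∈ edgesAt G v) :
    ∃ u, (e : Sym2 V) = s(v, u) := h

theorem lineGraph_adj_iff_mem_edgesMeeting {e e' : G.edgeSet} :
    G.lineGraph.Adj e e' ↔ e ≠ e' ∧ e' ∈ edgesMeeting e :=
  SimpleGraph.lineGraph_adj_iff_exists

theorem matchingWeight_insert_of_disjoint [DecidableEq G.edgeSet] {e : G.edgeSet}
    {S : Finset G.edgeSet} (h : Disjoint (S : Set G.edgeSet) (edgesMeeting e)) :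
    matchingWeight G lam (insert e S) = lam * matchingWeight G lam S := by
  have heS : e ∉ S := fun heS => Set.disjoint_left.1 h heS (mem_edgesMeeting_self e)
  have hsing : IsMatching G {e} := by
    rintro a rfl b rfl
    exact G.lineGraph.irrefl
  have hiff : IsMatching G (insert e S : Finset G.edgeSet) ↔ IsMatching G (S : Set G.edgeSet) := by
    rw [Finset.coe_insert, Set.insert_eq, isMatching_union]
    refine ⟨fun h => h.2.1, fun hS => ⟨hsing, hS, ?_⟩⟩
    rintro a rfl b hb hab
    exact Set.disjoint_left.1 h hb (lineGraph_adj_iff_mem_edgesMeeting.1 hab).2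
  classical simp only [matchingWeight, hiff, Finset.card_insert_of_notMem heS, pow_succ', mul_ite,
    mul_zero]

theorem matchingWeight_insert_of_not_disjoint [DecidableEq G.edgeSet] {e : G.edgeSet}
    {S : Finset G.edgeSet} (heS : e ∉ S) (h : ¬ Disjoint (S : Set G.edgeSet) (edgesMeeting e)) :
    matchingWeight G lam (insert e S) = 0 := by
  obtain ⟨e', he'S, he'⟩ := Set.not_disjoint_iff.1 h
  refine if_neg fun hm => hm e (by simp) e' (by simpa using Or.inr he'S) ?_
  exact lineGraph_adj_iff_mem_edgesMeeting.2 ⟨fun hee' => heS (hee' ▸ he'S), he'⟩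

theorem matchingSum_insert [DecidableEq G.edgeSet] {e : G.edgeSet} {F : Finset G.edgeSet}
    (he : e ∉ F) :
    matchingSum G lam (insert e F) =
      matchingSum G lam F + lam * matchingSum G lam (deleteEdges F (edgesMeeting e)) := by
  rw [matchingSum, Finset.sum_powerset_insert he, ← matchingSum,
    matchingSum.eq_1 G lam (deleteEdges F _), Finset.mul_sum]
  congr 1
  have hmem {S : Finset G.edgeSet} : S ∈ (deleteEdges F (edgesMeeting e)).powerset ↔
      S ⊆ F ∧ Disjoint (S : Set G.edgeSet) (edgesMeeting e) := by
    simp only [Finset.mem_powerset, Finset.subset_iff, mem_deleteEdges, Set.disjoint_left,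
      Finset.mem_coe, forall₂_and]
  rw [← Finset.sum_subset (Finset.powerset_mono.2 (deleteEdges_subset F (edgesMeeting e)))]
  · exact Finset.sum_congr rfl fun S hS => matchingWeight_insert_of_disjoint (hmem.1 hS).2
  · intro S hSF hS
    rw [Finset.mem_powerset] at hSF
    exact matchingWeight_insert_of_not_disjoint (fun heS => he (hSF heS))
      fun hdisj => hS (hmem.2 ⟨hSF, hdisj⟩)

theorem matchingSum_union_of_mem_edgesAt [DecidableEq G.edgeSet] {v : V} {F T : Finset G.edgeSet}
    (hF : ∀ e ∈ F, e ∉ edgesAt G v) (hT : ∀ e ∈ T, e ∈ edgesAt G v) :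
    matchingSum G lam (T ∪ F) = matchingSum G lam F +
      lam * ∑ e ∈ T, matchingSum G lam (deleteEdges F (edgesMeeting e)) := by
  induction T using Finset.induction_on with
  | empty => simp
  | insert e T heT ih =>
    have he : e ∈ edgesAt G v := hT e (Finset.mem_insert_self e T)
    have hT' : ∀ e' ∈ T, e' ∈ edgesAt G v := fun e' he' => hT e' (Finset.mem_insert_of_mem he')
    have heTF : e ∉ T ∪ F := by
      rw [Finset.mem_union, not_or]
      exact ⟨heT, fun heF => hF e heF he⟩
    have hdel : deleteEdges (T ∪ F) (edgesMeeting e) = deleteEdges F (edgesMeeting e) := by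
      ext e'
      simp only [mem_deleteEdges, Finset.mem_union, and_congr_left_iff, or_iff_right_iff_imp]
      exact fun hnot he' => absurd ⟨v, he, hT' e' he'⟩ hnot
    rw [Finset.insert_union, matchingSum_insert heTF, hdel, ih hT', Finset.sum_insert heT]
    ring

end MatchingSum

section Avoidance

variable {V : Type*} {G : SimpleGraph V} {lam : ℝ}

/-- The probability that a random matching `M ⊆ F`, chosen with probability proportional to
`λ^|M|`, contains no edge of `A`. -/
noncomputable def avoidance (G : SimpleGraph V) (lam : ℝ) (F : Finset G.edgeSet)
    (A : Set G.edgeSet) : ℝ :=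
  matchingSum G lam (deleteEdges F A) / matchingSum G lam F

/-- The probability that the node `v` is not covered by a random matching contained in `F`. -/
noncomputable def vacancy (G : SimpleGraph V) (lam : ℝ) (F : Finset G.edgeSet) (v : V) : ℝ :=
  avoidance G lam F (edgesAt G v)

open Classical in
/-- The edges of the finite set `F` that are incident to the node `v`. -/
noncomputable def incident (F : Finset G.edgeSet) (v : V) : Finset G.edgeSet :=
  F.filter (· ∈ edgesAt G v)

theorem avoidance_pos (hlam : 0 ≤ lam) (F : Finset G.edgeSet) (A : Set G.edgeSet) :
    0 < avoidance G lam F A :=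
  div_pos (matchingSum_pos hlam _) (matchingSum_pos hlam _)

theorem avoidance_le_one (hlam : 0 ≤ lam) (F : Finset G.edgeSet) (A : Set G.edgeSet) :
    avoidance G lam F A ≤ 1 :=
  div_le_one_of_le₀ (matchingSum_mono hlam (deleteEdges_subset F A)) (matchingSum_pos hlam F).le

theorem avoidance_union (hlam : 0 ≤ lam) (F : Finset G.edgeSet) (A B : Set G.edgeSet) :
    avoidance G lam F (A ∪ B) = avoidance G lam F A * avoidance G lam (deleteEdges F A) B := by
  rw [avoidance, avoidance, avoidance, deleteEdges_deleteEdges, mul_comm,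
    div_mul_div_cancel₀ (matchingSum_pos hlam (deleteEdges F A)).ne']

theorem avoidance_edgesMeeting (hlam : 0 ≤ lam) (F : Finset G.edgeSet) {e : G.edgeSet} {u v : V}
    (h : (e : Sym2 V) = s(u, v)) :
    avoidance G lam F (edgesMeeting e) =
      vacancy G lam F u * vacancy G lam (deleteEdges F (edgesAt G u)) v := by
  rw [edgesMeeting_eq_union h, avoidance_union hlam, vacancy, vacancy]

theorem avoidance_singleton (hlam : 0 ≤ lam) {F : Finset G.edgeSet} {e : G.edgeSet} (he : e ∈ F) :
    avoidance G lam F {e} = 1 - lam * avoidance G lam F (edgesMeeting e) := by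
  classical
  have heF : e ∉ deleteEdges F {e} := fun h => (mem_deleteEdges.1 h).2 rfl
  have hinsert : insert e (deleteEdges F {e}) = F := by
    ext e'
    simp only [Finset.mem_insert, mem_deleteEdges, Set.mem_singleton_iff]
    grind
  have hdel :
      deleteEdges (deleteEdges F {e}) (edgesMeeting e) = deleteEdges F (edgesMeeting e) := by
    rw [deleteEdges_deleteEdges,
      Set.union_eq_self_of_subset_left (Set.singleton_subset_iff.2 (mem_edgesMeeting_self e))]
  have hsum := matchingSum_insert (lam := lam) heF
  rw [hinsert, hdel] at hsum
  have hne := (matchingSum_pos hlam F).ne'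
  rw [avoidance, avoidance]
  field_simp
  linarith

theorem mem_incident {F : Finset G.edgeSet} {v : V} {e : G.edgeSet} :
    e ∈ incident F v ↔ e ∈ F ∧ e ∈ edgesAt G v := by
  simp [incident]

theorem vacancy_recursion (hlam : 0 ≤ lam) (F : Finset G.edgeSet) (v : V) :
    vacancy G lam F v = (1 + lam * ∑ e ∈ incident F v,
      avoidance G lam (deleteEdges F (edgesAt G v)) (edgesMeeting e))⁻¹ := by
  classical
  have hsplit : incident F v ∪ deleteEdges F (edgesAt G v) = F :=
    Finset.filter_union_filter_not_eq _ _
  have hsum := matchingSum_union_of_mem_edgesAt (lam := lam) (F := deleteEdges F (edgesAt G v))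
    (fun e he => (mem_deleteEdges.1 he).2) (fun e he => (mem_incident (F := F).1 he).2)
  rw [hsplit] at hsum
  have hne := (matchingSum_pos hlam (deleteEdges F (edgesAt G v))).ne'
  simp only [avoidance, ← Finset.sum_div]
  rw [vacancy, avoidance, hsum, ← inv_div]
  congr 1
  field_simp

theorem avoidance_deleteEdges_edgesMeeting (F : Finset G.edgeSet) {e : G.edgeSet} {u v : V}
    (h : (e : Sym2 V) = s(v, u)) :
    avoidance G lam (deleteEdges F (edgesAt G v)) (edgesMeeting e) =
      vacancy G lam (deleteEdges F (edgesAt G v)) u := by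
  simp only [vacancy, avoidance, deleteEdges_deleteEdges, edgesMeeting_eq_union h,
    ← Set.union_assoc, Set.union_self]

end Avoidance

section CorrelationDecay

variable {V : Type*} {G : SimpleGraph V} {lam : ℝ}

theorem finite_edgesAt [G.LocallyFinite] (v : V) : (edgesAt G v).Finite := by
  classical
  exact ((G.incidenceFinset v).finite_toSet.preimage Subtype.val_injective.injOn).subset
    fun e he => (G.mem_incidenceFinset v e).2 ⟨e.2, he⟩

theorem card_incident_le_degree [G.LocallyFinite] (F : Finset G.edgeSet) (v : V) :
    (incident F v).card ≤ G.degree v := by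
  classical
  rw [← G.card_incidenceFinset_eq_degree]
  exact Finset.card_le_card_of_injOn Subtype.val
    (fun e he => (G.mem_incidenceFinset v e).2 ⟨e.2, (mem_incident.1 he).2⟩)
    Subtype.val_injective.injOn

theorem sum_incident_avoidance_le [G.LocallyFinite] {Δ : ℕ} (hΔ : ∀ v, G.degree v ≤ Δ)
    (hlam : 0 ≤ lam) (F F' : Finset G.edgeSet) (v : V) (A : G.edgeSet → Set G.edgeSet) :
    ∑ e ∈ incident F v, avoidance G lam F' (A e) ≤ Δ := by
  calc ∑ e ∈ incident F v, avoidance G lam F' (A e)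
      ≤ ∑ e ∈ incident F v, 1 := Finset.sum_le_sum fun e _ => avoidance_le_one hlam F' (A e)
    _ = (incident F v).card := by simp
    _ ≤ Δ := by exact_mod_cast (card_incident_le_degree F v).trans (hΔ v)

theorem inv_one_add_le_vacancy [G.LocallyFinite] {Δ : ℕ} (hΔ : ∀ v, G.degree v ≤ Δ)
    (hlam : 0 ≤ lam) (F : Finset G.edgeSet) (v : V) : (1 + lam * Δ)⁻¹ ≤ vacancy G lam F v := by
  have hnonneg : 0 ≤ ∑ e ∈ incident F v,
      avoidance G lam (deleteEdges F (edgesAt G v)) (edgesMeeting e) :=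
    Finset.sum_nonneg fun e _ => (avoidance_pos hlam _ _).le
  rw [vacancy_recursion hlam]
  gcongr
  exact sum_incident_avoidance_le hΔ hlam F _ v edgesMeeting

/-- After `r` steps of the cavity recursion with total edge weight at most `K` at each node, two
vacancy probabilities differ at most by the factor `1 + decay K r`. -/
noncomputable def decay (K : ℝ) (r : ℕ) : ℝ := K * (K / (1 + K)) ^ r

theorem decay_nonneg {K : ℝ} (hK : 0 ≤ K) (r : ℕ) : 0 ≤ decay K r := by
  unfold decay
  positivity

theorem decay_succ (K : ℝ) (r : ℕ) : decay K (r + 1) = decay K r * (K / (1 + K)) := by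
  rw [decay, decay, pow_succ, mul_assoc K]

theorem tendsto_decay {K : ℝ} (hK : 0 ≤ K) : Tendsto (decay K) atTop (𝓝 0) := by
  have hlt : K / (1 + K) < 1 := (div_lt_one (by positivity)).2 (by linarith)
  rw [← mul_zero K]
  exact (tendsto_pow_atTop_nhds_zero_of_lt_one (by positivity) hlt).const_mul K

theorem inv_one_add_le_mul_inv_one_add {K δ a b : ℝ} (hδ : 0 ≤ δ) (ha : 0 ≤ a) (haK : a ≤ K)
    (hb : 0 ≤ b) (hba : b ≤ (1 + δ) * a) :
    (1 + a)⁻¹ ≤ (1 + δ * (K / (1 + K))) * (1 + b)⁻¹ := by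
  have hK : 0 ≤ K := ha.trans haK
  have hratio : a / (1 + a) ≤ K / (1 + K) := by
    rw [div_le_div_iff₀ (by positivity) (by positivity)]
    linarith
  rw [← div_eq_mul_inv, le_div_iff₀ (by positivity)]
  calc (1 + a)⁻¹ * (1 + b) ≤ (1 + a)⁻¹ * (1 + (1 + δ) * a) := by gcongr
    _ = 1 + δ * (a / (1 + a)) := by field_simp; ring
    _ ≤ 1 + δ * (K / (1 + K)) := by gcongr

theorem incident_eq_incident {F F' : Finset G.edgeSet} {v : V}
    (h : ∀ e ∈ edgesAt G v, e ∈ F ↔ e ∈ F') : incident F v = incident F' v := by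
  ext e
  simp only [mem_incident, and_congr_left_iff]
  exact h e

theorem vacancy_le_mul_vacancy [G.LocallyFinite] {Δ : ℕ} (hΔ : ∀ v, G.degree v ≤ Δ)
    (hlam : 0 ≤ lam) {δ : ℝ} (hδ : 0 ≤ δ) {F F' : Finset G.edgeSet} {v : V}
    (hincident : incident F v = incident F' v)
    (h : ∀ e ∈ incident F v,
      avoidance G lam (deleteEdges F' (edgesAt G v)) (edgesMeeting e) ≤
        (1 + δ) * avoidance G lam (deleteEdges F (edgesAt G v)) (edgesMeeting e)) :
    vacancy G lam F v ≤ (1 + δ * (lam * Δ / (1 + lam * Δ))) * vacancy G lam F' v := by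
  have hnonneg (F' : Finset G.edgeSet) : 0 ≤ lam * ∑ e ∈ incident F v,
      avoidance G lam F' (edgesMeeting e) :=
    mul_nonneg hlam (Finset.sum_nonneg fun e _ => (avoidance_pos hlam _ _).le)
  rw [vacancy_recursion hlam F, vacancy_recursion hlam F', ← hincident]
  refine inv_one_add_le_mul_inv_one_add hδ (hnonneg _)
    (mul_le_mul_of_nonneg_left (sum_incident_avoidance_le hΔ hlam F _ v edgesMeeting) hlam)
    (hnonneg _) ?_
  rw [mul_left_comm (1 + δ)]
  exact mul_le_mul_of_nonneg_left ((Finset.sum_le_sum h).trans_eq (Finset.mul_sum ..).symm) hlam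

theorem exists_vacancy_le_mul [G.LocallyFinite] {Δ : ℕ} (hΔ : ∀ v, G.degree v ≤ Δ)
    (hlam : 0 ≤ lam) (r : ℕ) (v : V) :
    ∃ B : Finset G.edgeSet, ∀ F F' : Finset G.edgeSet, (∀ e ∈ B, e ∈ F ↔ e ∈ F') →
      vacancy G lam F v ≤ (1 + decay (lam * Δ) r) * vacancy G lam F' v := by
  classical
  induction r generalizing v with
  | zero =>
    refine ⟨∅, fun F F' _ => ?_⟩
    calc vacancy G lam F v ≤ 1 := avoidance_le_one hlam _ _
      _ = (1 + decay (lam * Δ) 0) * (1 + lam * Δ)⁻¹ := by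
        rw [decay, pow_zero, mul_one, mul_inv_cancel₀ (by positivity)]
      _ ≤ (1 + decay (lam * Δ) 0) * vacancy G lam F' v := by
        have := decay_nonneg (mul_nonneg hlam Δ.cast_nonneg) 0
        gcongr
        exact inv_one_add_le_vacancy hΔ hlam F' v
  | succ r ih =>
    choose B hB using ih
    refine ⟨(finite_edgesAt v).toFinset ∪ (G.neighborFinset v).biUnion B, fun F F' hFF' => ?_⟩
    have hincident : incident F v = incident F' v := incident_eq_incident fun e he =>
      hFF' e (Finset.mem_union_left _ ((finite_edgesAt v).mem_toFinset.2 he))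
    have hstep : ∀ e ∈ incident F v,
        avoidance G lam (deleteEdges F' (edgesAt G v)) (edgesMeeting e) ≤
          (1 + decay (lam * Δ) r) *
            avoidance G lam (deleteEdges F (edgesAt G v)) (edgesMeeting e) := by
      intro e he
      obtain ⟨u, hu⟩ := exists_eq_mk_of_mem_edgesAt (mem_incident.1 he).2
      have hvu : u ∈ G.neighborFinset v := by
        rw [SimpleGraph.mem_neighborFinset, ← SimpleGraph.mem_edgeSet, ← hu]
        exact e.2
      rw [avoidance_deleteEdges_edgesMeeting F hu, avoidance_deleteEdges_edgesMeeting F' hu]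
      refine hB u _ _ fun e' he' => ?_
      rw [mem_deleteEdges, mem_deleteEdges,
        hFF' e' (Finset.mem_union_right _ (Finset.mem_biUnion.2 ⟨u, hvu, he'⟩))]
    rw [decay_succ]
    exact vacancy_le_mul_vacancy hΔ hlam (decay_nonneg (by positivity) r) hincident hstep

theorem exists_tendsto_vacancy [G.LocallyFinite] {Δ : ℕ} (hΔ : ∀ v, G.degree v ≤ Δ)
    (hlam : 0 ≤ lam) (D : Set G.edgeSet) (v : V) :
    ∃ L, Tendsto (fun F => vacancy G lam (deleteEdges F D) v) atTop (𝓝 L) := by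
  classical
  refine cauchySeq_tendsto_of_complete (Metric.cauchySeq_iff.2 fun ε hε => ?_)
  obtain ⟨r, hr⟩ := ((tendsto_decay (mul_nonneg hlam Δ.cast_nonneg)).eventually_lt_const hε).exists
  obtain ⟨B, hB⟩ := exists_vacancy_le_mul hΔ hlam r v
  have hle {F F' : Finset G.edgeSet} (hF : B ⊆ F) (hF' : B ⊆ F') :
      vacancy G lam (deleteEdges F D) v - vacancy G lam (deleteEdges F' D) v < ε := by
    have hratio := hB (deleteEdges F D) (deleteEdges F' D) fun e he => by
      simp only [mem_deleteEdges, hF he, hF' he]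
    have hone := mul_le_of_le_one_right (decay_nonneg (mul_nonneg hlam Δ.cast_nonneg) r)
      (avoidance_le_one hlam (deleteEdges F' D) (edgesAt G v))
    rw [← vacancy] at hone
    linarith
  refine ⟨B, fun F hF F' hF' => abs_sub_lt_iff.2 ⟨hle hF hF', hle hF' hF⟩⟩

theorem exists_tendsto_avoidance_singleton [G.LocallyFinite] {Δ : ℕ} (hΔ : ∀ v, G.degree v ≤ Δ)
    (hlam : 0 ≤ lam) (D : Set G.edgeSet) (e : G.edgeSet) :
    ∃ L, Tendsto (fun F => avoidance G lam (deleteEdges F D) {e}) atTop (𝓝 L) := by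
  by_cases heD : e ∈ D
  · have hD : D ∪ {e} = D := Set.union_eq_self_of_subset_right (Set.singleton_subset_iff.2 heD)
    refine ⟨1, tendsto_const_nhds.congr fun F => ?_⟩
    rw [avoidance, deleteEdges_deleteEdges, hD, div_self (matchingSum_pos hlam _).ne']
  · obtain ⟨⟨u, v⟩, huv⟩ := Sym2.mk_surjective (e : Sym2 V)
    obtain ⟨L, hL⟩ := exists_tendsto_vacancy hΔ hlam D u
    obtain ⟨L', hL'⟩ := exists_tendsto_vacancy hΔ hlam (D ∪ edgesAt G u) v
    refine ⟨1 - lam * (L * L'), (((hL.mul hL').const_mul lam).const_sub 1).congr' ?_⟩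
    filter_upwards [eventually_ge_atTop {e}] with F heF
    rw [avoidance_singleton hlam
      (mem_deleteEdges.2 ⟨Finset.singleton_subset_iff.1 heF, heD⟩),
      avoidance_edgesMeeting hlam _ huv.symm, deleteEdges_deleteEdges]

theorem exists_tendsto_avoidance [G.LocallyFinite] {Δ : ℕ} (hΔ : ∀ v, G.degree v ≤ Δ)
    (hlam : 0 ≤ lam) {A : Set G.edgeSet} (hA : A.Finite) (D : Set G.edgeSet) :
    ∃ L, Tendsto (fun F => avoidance G lam (deleteEdges F D) A) atTop (𝓝 L) := by
  induction A, hA using Set.Finite.induction_on generalizing D with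
  | empty =>
    refine ⟨1, tendsto_const_nhds.congr fun F => ?_⟩
    rw [avoidance, deleteEdges_empty, div_self (matchingSum_pos hlam _).ne']
  | @insert e A _ _ ih =>
    obtain ⟨L, hL⟩ := exists_tendsto_avoidance_singleton hΔ hlam D e
    obtain ⟨L', hL'⟩ := ih (D ∪ {e})
    refine ⟨L * L', (hL.mul hL').congr fun F => ?_⟩
    rw [Set.insert_eq, avoidance_union hlam, deleteEdges_deleteEdges]

end CorrelationDecay

section Uniqueness

variable {V : Type*} {G : SimpleGraph V} {lam : ℝ}

/-- The event that the random matching contains no edge of `A`. -/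
def avoiding (A : Set G.edgeSet) : Set (Config G) := {σ | ∀ e ∈ A, σ e = false}

/-- The event that the random matching coincides with `S` inside `F`. -/
def agreeing (F S : Finset G.edgeSet) : Set (Config G) := {σ | ∀ e ∈ F, (σ e = true ↔ e ∈ S)}

/-- The edges of `F` that are not blocked by an edge of `σ` outside `F`. -/
noncomputable def allowed (F : Finset G.edgeSet) (σ : Config G) : Finset G.edgeSet :=
  deleteEdges F {e | ∃ e' ∉ F, σ e' = true ∧ G.lineGraph.Adj e e'}

theorem unmatched_eq_avoiding (v : V) : unmatched G v = avoiding (edgesAt G v) := rfl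

theorem avoiding_union (A B : Set G.edgeSet) : avoiding (A ∪ B) = avoiding A ∩ avoiding B := by
  ext σ
  simp only [avoiding, Set.mem_union, or_imp, forall_and, Set.mem_ofPred_eq, Set.mem_inter_iff]

theorem mem_allowed {F : Finset G.edgeSet} {σ : Config G} {e : G.edgeSet} :
    e ∈ allowed F σ ↔ e ∈ F ∧ ∀ e' ∉ F, σ e' = true → ¬ G.lineGraph.Adj e e' := by
  simp only [allowed, mem_deleteEdges, Set.mem_ofPred_eq, not_exists, not_and]

theorem compatible_iff_subset_allowed {F S : Finset G.edgeSet} {σ : Config G} (hS : S ⊆ F) :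
    Compatible G F S σ ↔ IsMatching G (S : Set G.edgeSet) ∧ S ⊆ allowed F σ := by
  refine and_congr_right fun _ => forall₂_congr fun e he => ?_
  rw [mem_allowed, and_iff_right (hS he)]

theorem weight_nonneg (hlam : 0 ≤ lam) (F S : Finset G.edgeSet) (σ : Config G) :
    0 ≤ weight G lam F S σ := by
  unfold weight
  split_ifs <;> positivity

theorem weight_eq_matchingWeight {F S : Finset G.edgeSet} {σ : Config G} (h : S ⊆ allowed F σ) :
    weight G lam F S σ = matchingWeight G lam S := by
  have hiff := compatible_iff_subset_allowed (σ := σ) (h.trans (deleteEdges_subset F _))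
  rw [and_iff_left h] at hiff
  classical simp only [weight, matchingWeight, hiff]

theorem weight_eq_zero {F S : Finset G.edgeSet} {σ : Config G} (hSF : S ⊆ F)
    (h : ¬ S ⊆ allowed F σ) : weight G lam F S σ = 0 :=
  if_neg fun hcompat => h ((compatible_iff_subset_allowed hSF).1 hcompat).2

theorem sum_weight_deleteEdges (F : Finset G.edgeSet) (A : Set G.edgeSet) (σ : Config G) :
    ∑ S ∈ (deleteEdges F A).powerset, weight G lam F S σ =
      matchingSum G lam (deleteEdges (allowed F σ) A) := by
  have hmem {S : Finset G.edgeSet} : S ∈ (deleteEdges (allowed F σ) A).powerset ↔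
      S ⊆ deleteEdges F A ∧ S ⊆ allowed F σ := by
    simp only [Finset.mem_powerset, Finset.subset_iff, mem_deleteEdges, mem_allowed]
    grind
  have hsub : (deleteEdges (allowed F σ) A).powerset ⊆ (deleteEdges F A).powerset :=
    fun S hS => Finset.mem_powerset.2 (hmem.1 hS).1
  rw [matchingSum, ← Finset.sum_subset hsub]
  · exact Finset.sum_congr rfl fun S hS => weight_eq_matchingWeight (hmem.1 hS).2
  · intro S hSF hS
    rw [Finset.mem_powerset] at hSF
    exact weight_eq_zero (hSF.trans (deleteEdges_subset F A)) fun h => hS (hmem.2 ⟨hSF, h⟩)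

theorem sum_weight (F : Finset G.edgeSet) (σ : Config G) :
    ∑ S ∈ F.powerset, weight G lam F S σ = matchingSum G lam (allowed F σ) := by
  simpa only [deleteEdges_empty] using sum_weight_deleteEdges F ∅ σ

theorem sum_finiteGibbs_deleteEdges (F : Finset G.edgeSet) (A : Set G.edgeSet) (σ : Config G) :
    ∑ S ∈ (deleteEdges F A).powerset, finiteGibbs G lam F S σ =
      avoidance G lam (allowed F σ) A := by
  simp only [finiteGibbs, sum_weight]
  rw [← Finset.sum_div, sum_weight_deleteEdges, avoidance]

theorem measurableSet_cylinderEvents_avoiding {A s : Set G.edgeSet} (hA : A.Countable)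
    (hAs : A ⊆ s) :
    MeasurableSet[cylinderEvents (X := fun _ : G.edgeSet => Bool) s] (avoiding A) := by
  have hInter : avoiding A = ⋂ e ∈ A, (fun σ : Config G => σ e) ⁻¹' {false} := by
    ext σ
    simp only [avoiding, Set.mem_ofPred_eq, Set.mem_iInter, Set.mem_preimage,
      Set.mem_singleton_iff]
  rw [hInter]
  exact MeasurableSet.biInter hA fun e he =>
    measurable_cylinderEvent_apply (hAs he) (measurableSet_singleton _)

theorem measurableSet_avoiding {A : Set G.edgeSet} (hA : A.Countable) :
    MeasurableSet (avoiding A) :=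
  cylinderEvents_le_pi _ (measurableSet_cylinderEvents_avoiding hA (Set.subset_univ A))

theorem measurableSet_agreeing (F S : Finset G.edgeSet) : MeasurableSet (agreeing F S) := by
  have hInter : agreeing F S =
      ⋂ e ∈ F, (fun σ : Config G => σ e) ⁻¹' {b | b = true ↔ e ∈ S} := by
    ext σ
    simp only [agreeing, Set.mem_ofPred_eq, Set.mem_iInter, Set.mem_preimage]
  rw [hInter]
  exact F.measurableSet_biInter fun e _ => measurable_pi_apply e (Set.toFinite _).measurableSet

theorem avoiding_eq_biUnion_agreeing {A : Set G.edgeSet} {F : Finset G.edgeSet}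
    (h : A ⊆ F) : avoiding A = ⋃ S ∈ (deleteEdges F A).powerset, agreeing F S := by
  ext σ
  simp only [avoiding, agreeing, Set.mem_ofPred_eq, Set.mem_iUnion, Finset.mem_powerset,
    exists_prop]
  constructor
  · intro hσ
    refine ⟨F.filter fun e => σ e = true, fun e he => ?_, fun e he => by simp [he]⟩
    rw [Finset.mem_filter] at he
    refine mem_deleteEdges.2 ⟨he.1, fun heA => ?_⟩
    simp [hσ e heA] at he
  · rintro ⟨S, hS, hσ⟩ e he
    have heS : e ∉ S := fun heS => (mem_deleteEdges.1 (hS heS)).2 he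
    simpa [heS] using hσ e (h he)

theorem pairwiseDisjoint_agreeing (F : Finset G.edgeSet) :
    (F.powerset : Set (Finset G.edgeSet)).PairwiseDisjoint (agreeing F) := by
  intro S hS T hT hST
  refine Set.disjoint_left.2 fun σ hσS hσT => hST ?_
  rw [Finset.mem_coe, Finset.mem_powerset] at hS hT
  ext e
  exact ⟨fun he => (hσT e (hS he)).1 ((hσS e (hS he)).2 he),
    fun he => (hσS e (hT he)).1 ((hσT e (hT he)).2 he)⟩

namespace IsGibbsMeasure

variable {μ : Measure (Config G)}

theorem integrable_finiteGibbs (hμ : IsGibbsMeasure G lam μ) {F S : Finset G.edgeSet}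
    (hS : S ⊆ F) : Integrable (finiteGibbs G lam F S) μ :=
  integrable_condExp.congr (hμ.condProb F S hS)

theorem measureReal_agreeing (hμ : IsGibbsMeasure G lam μ) {F S : Finset G.edgeSet}
    (hS : S ⊆ F) : μ.real (agreeing F S) = ∫ σ, finiteGibbs G lam F S σ ∂μ := by
  have := hμ.isProbabilityMeasure
  rw [← integral_congr_ae (hμ.condProb F S hS), integral_condExp cylinderEvents_le_pi]
  exact (integral_indicator_one (measurableSet_agreeing F S)).symm

theorem integrable_avoidance_allowed (hμ : IsGibbsMeasure G lam μ) (F : Finset G.edgeSet)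
    (A : Set G.edgeSet) : Integrable (fun σ => avoidance G lam (allowed F σ) A) μ := by
  simp only [← sum_finiteGibbs_deleteEdges]
  exact integrable_finsetSum _ fun S hS => hμ.integrable_finiteGibbs
    ((Finset.mem_powerset.1 hS).trans (deleteEdges_subset F A))

theorem measureReal_avoiding (hμ : IsGibbsMeasure G lam μ) {A : Set G.edgeSet}
    {F : Finset G.edgeSet} (hA : A ⊆ F) :
    μ.real (avoiding A) = ∫ σ, avoidance G lam (allowed F σ) A ∂μ := by
  have := hμ.isProbabilityMeasure
  have hsub := Finset.powerset_mono.2 (deleteEdges_subset F A)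
  have hF : ∀ S ∈ (deleteEdges F A).powerset, S ⊆ F := fun S hS => Finset.mem_powerset.1 (hsub hS)
  simp only [← sum_finiteGibbs_deleteEdges]
  rw [integral_finsetSum _ fun S hS => hμ.integrable_finiteGibbs (hF S hS),
    avoiding_eq_biUnion_agreeing hA,
    measureReal_biUnion_finset ((pairwiseDisjoint_agreeing F).subset hsub)
      fun S _ => measurableSet_agreeing F S]
  exact Finset.sum_congr rfl fun S hS => hμ.measureReal_agreeing (hF S hS)

end IsGibbsMeasure

theorem finite_edgesMeeting [G.LocallyFinite] (e : G.edgeSet) : (edgesMeeting e).Finite := by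
  obtain ⟨⟨u, v⟩, huv⟩ := Sym2.mk_surjective (e : Sym2 V)
  rw [edgesMeeting_eq_union huv.symm]
  exact (finite_edgesAt u).union (finite_edgesAt v)

theorem exists_finset_edgesMeeting_subset [G.LocallyFinite] (B : Finset G.edgeSet) :
    ∃ C : Finset G.edgeSet, ∀ e ∈ B, edgesMeeting e ⊆ C := by
  have hfin : (⋃ e ∈ B, edgesMeeting e).Finite :=
    B.finite_toSet.biUnion fun e _ => finite_edgesMeeting e
  refine ⟨hfin.toFinset, fun e he => ?_⟩
  rw [hfin.coe_toFinset]
  exact Set.subset_biUnion_of_mem (u := edgesMeeting) he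

theorem subset_allowed {B F : Finset G.edgeSet} (h : ∀ e ∈ B, edgesMeeting e ⊆ F)
    (σ : Config G) : B ⊆ allowed F σ := fun e he =>
  mem_allowed.2 ⟨h e he (mem_edgesMeeting_self e), fun _ he' _ hadj =>
    he' (h e he (lineGraph_adj_iff_mem_edgesMeeting.1 hadj).2)⟩

namespace IsGibbsMeasure

variable {μ ν : Measure (Config G)}

theorem measureReal_avoiding_eq_of_tendsto [G.LocallyFinite] (hμ : IsGibbsMeasure G lam μ)
    {A : Set G.edgeSet} (hA : A.Finite) {L : ℝ}
    (hL : Tendsto (fun F => avoidance G lam F A) atTop (𝓝 L)) : μ.real (avoiding A) = L := by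
  classical
  have := hμ.isProbabilityMeasure
  refine eq_of_abs_sub_le_all fun ε hε => ?_
  obtain ⟨B, hB⟩ := eventually_atTop.1 (Metric.tendsto_nhds.1 hL ε hε)
  obtain ⟨C, hC⟩ := exists_finset_edgesMeeting_subset B
  have hallowed (σ : Config G) : B ⊆ allowed (hA.toFinset ∪ C) σ :=
    subset_allowed (fun e he => (hC e he).trans (Finset.coe_subset.2 Finset.subset_union_right)) σ
  have hdiff : μ.real (avoiding A) - L =
      ∫ σ, (avoidance G lam (allowed (hA.toFinset ∪ C) σ) A - L) ∂μ := by
    rw [integral_sub (hμ.integrable_avoidance_allowed _ A) (integrable_const L),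
      ← hμ.measureReal_avoiding (by simp), integral_const, probReal_univ, one_smul]
  rw [hdiff, ← Real.norm_eq_abs]
  have hclose (σ : Config G) :
      ‖avoidance G lam (allowed (hA.toFinset ∪ C) σ) A - L‖ ≤ ε := (hB _ (hallowed σ)).le
  simpa using norm_integral_le_of_norm_le_const (μ := μ) (ae_of_all _ hclose)

end IsGibbsMeasure

theorem isPiSystem_avoiding (s : Set G.edgeSet) :
    IsPiSystem (avoiding '' {A : Set G.edgeSet | A.Finite ∧ A ⊆ s}) := by
  rintro _ ⟨A, hA, rfl⟩ _ ⟨B, hB, rfl⟩ _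
  exact ⟨A ∪ B, ⟨hA.1.union hB.1, Set.union_subset hA.2 hB.2⟩, avoiding_union A B⟩

theorem cylinderEvents_eq_generateFrom_avoiding (s : Set G.edgeSet) :
    cylinderEvents (X := fun _ : G.edgeSet => Bool) s =
      MeasurableSpace.generateFrom (avoiding '' {A : Set G.edgeSet | A.Finite ∧ A ⊆ s}) := by
  apply le_antisymm
  · refine iSup₂_le fun e he => measurable_iff_comap_le.1 ?_
    refine @measurable_to_bool _ (MeasurableSpace.generateFrom _) _ ?_
    have hcompl : (fun σ : Config G => σ e) ⁻¹' {true} = (avoiding {e})ᶜ := by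
      ext σ
      simp [avoiding]
    rw [hcompl]
    exact MeasurableSet.compl (MeasurableSpace.measurableSet_generateFrom
      ⟨{e}, ⟨Set.finite_singleton e, Set.singleton_subset_iff.2 he⟩, rfl⟩)
  · refine MeasurableSpace.generateFrom_le ?_
    rintro _ ⟨A, hA, rfl⟩
    exact measurableSet_cylinderEvents_avoiding hA.1.countable hA.2

namespace IsGibbsMeasure

variable {μ ν : Measure (Config G)}

theorem unique [G.LocallyFinite] {Δ : ℕ} (hΔ : ∀ v, G.degree v ≤ Δ) (hlam : 0 ≤ lam)
    (hμ : IsGibbsMeasure G lam μ) (hν : IsGibbsMeasure G lam ν) : μ = ν := by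
  have := hμ.isProbabilityMeasure
  have := hν.isProbabilityMeasure
  refine ext_of_generate_finite _
    (cylinderEvents_univ.symm.trans (cylinderEvents_eq_generateFrom_avoiding Set.univ))
    (isPiSystem_avoiding _) ?_ (by rw [measure_univ, measure_univ])
  rintro _ ⟨A, ⟨hA, -⟩, rfl⟩
  obtain ⟨L, hL⟩ := exists_tendsto_avoidance hΔ hlam hA ∅
  simp only [deleteEdges_empty] at hL
  rw [← measureReal_eq_measureReal_iff, hμ.measureReal_avoiding_eq_of_tendsto hA hL,
    hν.measureReal_avoiding_eq_of_tendsto hA hL]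

theorem tendsto_vacancy [G.LocallyFinite] {Δ : ℕ} (hΔ : ∀ v, G.degree v ≤ Δ) (hlam : 0 ≤ lam)
    (hμ : IsGibbsMeasure G lam μ) (v : V) :
    Tendsto (fun F => vacancy G lam F v) atTop (𝓝 (μ.real (unmatched G v))) := by
  obtain ⟨L, hL⟩ := exists_tendsto_vacancy hΔ hlam ∅ v
  simp only [deleteEdges_empty] at hL
  rwa [unmatched_eq_avoiding, hμ.measureReal_avoiding_eq_of_tendsto (finite_edgesAt v) hL]

theorem measureReal_unmatched_pos [G.LocallyFinite] {Δ : ℕ} (hΔ : ∀ v, G.degree v ≤ Δ)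
    (hlam : 0 ≤ lam) (hμ : IsGibbsMeasure G lam μ) (v : V) : 0 < μ.real (unmatched G v) :=
  lt_of_lt_of_le (inv_pos.2 (by positivity)) <|
    ge_of_tendsto' (hμ.tendsto_vacancy hΔ hlam v) fun F => inv_one_add_le_vacancy hΔ hlam F v

end IsGibbsMeasure

end Uniqueness

section Existence

theorem sum_powerset_eq_sum_sum_powerset {α β : Type*} [DecidableEq α] [AddCommMonoid β]
    {F F' : Finset α} (hF : F ⊆ F') (g : Finset α → Finset α → β) :
    ∑ M ∈ F'.powerset, g (M \ F) (M ∩ F) =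
      ∑ R ∈ (F' \ F).powerset, ∑ T ∈ F.powerset, g R T := by
  rw [← Finset.sum_product']
  refine Finset.sum_nbij' (fun M => (M \ F, M ∩ F)) (fun p => p.1 ∪ p.2) ?_ ?_ ?_ ?_ fun _ _ => rfl
  · intro M hM
    rw [Finset.mem_powerset] at hM
    simp only [Finset.mem_product, Finset.mem_powerset]
    exact ⟨Finset.sdiff_subset_sdiff hM subset_rfl, Finset.inter_subset_right⟩
  · intro p hp
    simp only [Finset.mem_product, Finset.mem_powerset] at hp ⊢
    exact Finset.union_subset (hp.1.trans Finset.sdiff_subset) (hp.2.trans hF)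
  · exact fun M _ => Finset.sdiff_union_inter M F
  · rintro ⟨R, T⟩ hp
    simp only [Finset.mem_product, Finset.mem_powerset] at hp
    have hR : Disjoint R F := Finset.disjoint_of_subset_left hp.1 Finset.sdiff_disjoint
    rw [Finset.union_sdiff_distrib, Finset.union_inter_distrib_right,
      Finset.sdiff_eq_empty_iff_subset.2 hp.2, Finset.union_empty, hR.sdiff_eq_left,
      Finset.disjoint_iff_inter_eq_empty.1 hR, Finset.empty_union, Finset.inter_eq_left.2 hp.2]

theorem setIntegral_eq_setIntegral_of_isPiSystem {Ω : Type*} {m m₀ : MeasurableSpace Ω}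
    {μ : @Measure Ω m₀} (hm : m ≤ m₀) {C : Set (Set Ω)}
    (hC : m = MeasurableSpace.generateFrom C) (hpi : IsPiSystem C) (huniv : Set.univ ∈ C)
    {f g : Ω → ℝ} (hf : Integrable f μ) (hg : Integrable g μ)
    (h : ∀ s ∈ C, ∫ x in s, f x ∂μ = ∫ x in s, g x ∂μ) {s : Set Ω} (hs : MeasurableSet[m] s) :
    ∫ x in s, f x ∂μ = ∫ x in s, g x ∂μ := by
  induction s, hs using MeasurableSpace.induction_on_inter hC hpi with
  | empty => simp only [setIntegral_empty]
  | basic s hs => exact h s hs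
  | compl s hs ih =>
    have hint := h _ huniv
    rw [setIntegral_univ, setIntegral_univ] at hint
    rw [setIntegral_compl (hm s hs) hf, setIntegral_compl (hm s hs) hg, ih, hint]
  | iUnion s hdisj hs ih =>
    rw [integral_iUnion (fun i => hm _ (hs i)) hdisj hf.integrableOn,
      integral_iUnion (fun i => hm _ (hs i)) hdisj hg.integrableOn]
    exact tsum_congr ih

theorem exists_probabilityMeasure_integral_eq {Ω ι : Type*} [TopologicalSpace Ω] [CompactSpace Ω]
    [T2Space Ω] [MeasurableSpace Ω] [BorelSpace Ω] (l : Filter ι) [l.NeBot]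
    (ρ : ι → ProbabilityMeasure Ω) :
    ∃ μ : ProbabilityMeasure Ω, ∀ f g : Ω → ℝ, Continuous f → Continuous g →
      (∀ᶠ i in l, ∫ x, f x ∂(ρ i : Measure Ω) = ∫ x, g x ∂(ρ i : Measure Ω)) →
      ∫ x, f x ∂(μ : Measure Ω) = ∫ x, g x ∂(μ : Measure Ω) := by
  let U : Ultrafilter ι := Ultrafilter.of l
  have hlim : Tendsto ρ U (𝓝 (U.map ρ).lim) := (U.map ρ).le_nhds_lim
  have hint {f : Ω → ℝ} (hf : Continuous f) :
      Tendsto (fun i => ∫ x, f x ∂(ρ i : Measure Ω)) U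
        (𝓝 (∫ x, f x ∂((U.map ρ).lim : Measure Ω))) :=
    ProbabilityMeasure.tendsto_iff_forall_integral_tendsto.1 hlim
      (BoundedContinuousFunction.mkOfCompact ⟨f, hf⟩)
  exact ⟨(U.map ρ).lim, fun f g hf hg hfg =>
    tendsto_nhds_unique_of_eventuallyEq (hint hf) (hint hg) (Ultrafilter.of_le l hfg)⟩

variable {V : Type*} {G : SimpleGraph V} {lam : ℝ}

open Classical in
/-- The configuration whose set of occupied edges is the finite set `M`. -/
noncomputable def configOf (M : Finset G.edgeSet) : Config G := fun e => decide (e ∈ M)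

theorem configOf_eq_true {M : Finset G.edgeSet} {e : G.edgeSet} :
    configOf M e = true ↔ e ∈ M := by
  simp [configOf]

theorem configOf_sdiff_apply [DecidableEq G.edgeSet] {M F : Finset G.edgeSet} {e : G.edgeSet}
    (he : e ∉ F) : configOf (M \ F) e = configOf M e := by
  rw [Bool.eq_iff_iff, configOf_eq_true, configOf_eq_true, Finset.mem_sdiff, and_iff_left he]

theorem configOf_mem_agreeing [DecidableEq G.edgeSet] {M F S : Finset G.edgeSet} (hS : S ⊆ F) :
    configOf M ∈ agreeing F S ↔ M ∩ F = S := by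
  rw [Finset.ext_iff]
  refine forall_congr' fun e => ?_
  rw [configOf_eq_true, Finset.mem_inter]
  have := @hS e
  tauto

theorem matchingWeight_union [DecidableEq G.edgeSet] {F R T : Finset G.edgeSet}
    (hR : Disjoint R F) (hT : T ⊆ F) :
    matchingWeight G lam (R ∪ T) = matchingWeight G lam R * weight G lam F T (configOf R) := by
  have hiff : IsMatching G ((R ∪ T : Finset G.edgeSet) : Set G.edgeSet) ↔
      IsMatching G (R : Set G.edgeSet) ∧ Compatible G F T (configOf R) := by
    have hcross : (∀ e ∈ R, ∀ e' ∈ T, ¬ G.lineGraph.Adj e e') ↔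
        ∀ e ∈ T, ∀ e' ∉ F, configOf R e' = true → ¬ G.lineGraph.Adj e e' := by
      simp only [configOf_eq_true]
      exact ⟨fun h e he e' _ he' hadj => h e' he' e he hadj.symm,
        fun h e he e' he' hadj => h e' he' e (Finset.disjoint_left.1 hR he) he hadj.symm⟩
    rw [Finset.coe_union, isMatching_union]
    exact and_congr_right fun _ => and_congr_right fun _ => hcross
  classical
  simp only [matchingWeight, weight, hiff, ite_and, ite_zero_mul_ite_zero, ← pow_add,
    Finset.card_union_of_disjoint (Finset.disjoint_of_subset_right hT hR)]

theorem sum_matchingWeight_mul [DecidableEq G.edgeSet] {F F' : Finset G.edgeSet} (hF : F ⊆ F')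
    (g : Finset G.edgeSet → Finset G.edgeSet → ℝ) :
    ∑ M ∈ F'.powerset, matchingWeight G lam M * g (M \ F) (M ∩ F) =
      ∑ R ∈ (F' \ F).powerset, matchingWeight G lam R *
        ∑ T ∈ F.powerset, weight G lam F T (configOf R) * g R T := by
  have hsplit := sum_powerset_eq_sum_sum_powerset hF
    fun R T => matchingWeight G lam (R ∪ T) * g R T
  simp only [Finset.sdiff_union_inter] at hsplit
  rw [hsplit]
  refine Finset.sum_congr rfl fun R hR => ?_
  have hRF : Disjoint R F :=
    Finset.disjoint_of_subset_left (Finset.mem_powerset.1 hR) Finset.sdiff_disjoint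
  rw [Finset.mul_sum]
  refine Finset.sum_congr rfl fun T hT => ?_
  rw [matchingWeight_union hRF (Finset.mem_powerset.1 hT), mul_assoc]

theorem finiteGibbs_congr {F S : Finset G.edgeSet} (hS : S ⊆ F) {σ τ : Config G}
    (h : ∀ e ∈ F, ∀ e' ∈ edgesMeeting e, e' ∉ F → σ e' = τ e') :
    finiteGibbs G lam F S σ = finiteGibbs G lam F S τ := by
  have hallowed : allowed F σ = allowed F τ := by
    ext e
    simp only [mem_allowed, and_congr_right_iff]
    intro he
    refine forall₂_congr fun e' he' => ?_
    by_cases hadj : G.lineGraph.Adj e e'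
    · rw [h e he e' (lineGraph_adj_iff_mem_edgesMeeting.1 hadj).2 he']
    · simp only [hadj, not_false_eq_true, implies_true]
  have hweight : weight G lam F S σ = weight G lam F S τ := by
    by_cases hSallowed : S ⊆ allowed F σ
    · rw [weight_eq_matchingWeight hSallowed, weight_eq_matchingWeight (hallowed ▸ hSallowed)]
    · rw [weight_eq_zero hS hSallowed, weight_eq_zero hS (hallowed ▸ hSallowed)]
  rw [finiteGibbs, finiteGibbs, sum_weight, sum_weight, hallowed, hweight]

theorem finiteGibbs_configOf_sdiff [DecidableEq G.edgeSet] {F S : Finset G.edgeSet} (hS : S ⊆ F)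
    (M : Finset G.edgeSet) :
    finiteGibbs G lam F S (configOf (M \ F)) = finiteGibbs G lam F S (configOf M) :=
  finiteGibbs_congr hS fun _ _ _ _ he' => configOf_sdiff_apply he'

theorem sum_matchingWeight_mul_finiteGibbs [DecidableEq G.edgeSet] (hlam : 0 ≤ lam)
    {F F' S : Finset G.edgeSet} (hF : F ⊆ F') (hS : S ⊆ F) (φ : Finset G.edgeSet → ℝ) :
    ∑ M ∈ F'.powerset,
        matchingWeight G lam M * (φ (M \ F) * finiteGibbs G lam F S (configOf M)) =
      ∑ M ∈ F'.powerset, matchingWeight G lam M * (φ (M \ F) * if M ∩ F = S then 1 else 0) := by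
  rw [Finset.sum_congr rfl fun M _ => by rw [← finiteGibbs_configOf_sdiff hS M],
    sum_matchingWeight_mul hF fun R _ => φ R * finiteGibbs G lam F S (configOf R),
    sum_matchingWeight_mul hF fun R T => φ R * if T = S then 1 else 0]
  refine Finset.sum_congr rfl fun R _ => congrArg _ ?_
  calc ∑ T ∈ F.powerset, weight G lam F T (configOf R) *
        (φ R * finiteGibbs G lam F S (configOf R))
      = weight G lam F S (configOf R) * φ R := by
        have hpos : 0 < ∑ T ∈ F.powerset, weight G lam F T (configOf R) :=
          (sum_weight F (configOf R)).symm ▸ matchingSum_pos hlam _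
        rw [← Finset.sum_mul, finiteGibbs]
        field_simp
    _ = ∑ T ∈ F.powerset, weight G lam F T (configOf R) * (φ R * if T = S then 1 else 0) := by
        simp only [mul_ite, mul_one, mul_zero, Finset.sum_ite_eq', Finset.mem_powerset.2 hS,
          if_true]

/-- The law of a random matching contained in the finite set `F` of edges, as a measure on
configurations on `G`. -/
noncomputable def finiteMeasure (G : SimpleGraph V) (lam : ℝ) (F : Finset G.edgeSet) :
    Measure (Config G) :=
  ∑ M ∈ F.powerset,
    ENNReal.ofReal (matchingWeight G lam M / matchingSum G lam F) • Measure.dirac (configOf M)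

theorem isProbabilityMeasure_finiteMeasure (hlam : 0 ≤ lam) (F : Finset G.edgeSet) :
    IsProbabilityMeasure (finiteMeasure G lam F) := by
  have hZ : 0 < matchingSum G lam F := matchingSum_pos hlam F
  refine ⟨?_⟩
  simp only [finiteMeasure, Measure.coe_finsetSum, Finset.sum_apply, Measure.smul_apply,
    measure_univ, smul_eq_mul, mul_one]
  rw [← ENNReal.ofReal_sum_of_nonneg fun M _ => div_nonneg (matchingWeight_nonneg hlam M) hZ.le,
    ← Finset.sum_div, ← matchingSum, div_self hZ.ne', ENNReal.ofReal_one]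

theorem integral_finiteMeasure (hlam : 0 ≤ lam) (F : Finset G.edgeSet) {f : Config G → ℝ}
    (hf : StronglyMeasurable f) :
    ∫ σ, f σ ∂finiteMeasure G lam F =
      (∑ M ∈ F.powerset, matchingWeight G lam M * f (configOf M)) / matchingSum G lam F := by
  rw [finiteMeasure, integral_finsetSum_measure fun M _ =>
    (integrable_dirac' hf enorm_lt_top).smul_measure ENNReal.ofReal_ne_top, Finset.sum_div]
  refine Finset.sum_congr rfl fun M _ => ?_
  have hnonneg := div_nonneg (matchingWeight_nonneg hlam M) (matchingSum_pos hlam F).le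
  rw [integral_smul_measure, integral_dirac' _ _ hf, ENNReal.toReal_ofReal hnonneg, smul_eq_mul,
    div_mul_eq_mul_div]

theorem continuous_of_dependsOn {f : Config G → ℝ} {B : Finset G.edgeSet}
    (hf : DependsOn f (B : Set G.edgeSet)) : Continuous f := by
  obtain ⟨g, rfl⟩ := dependsOn_iff_exists_comp.1 hf
  exact continuous_of_discreteTopology.comp (Pi.continuous_domRestrict _)

theorem measurable_cylinderEvents_of_dependsOn {f : Config G → ℝ} {B : Finset G.edgeSet}
    {s : Set G.edgeSet} (hf : DependsOn f (B : Set G.edgeSet)) (hB : (B : Set G.edgeSet) ⊆ s) :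
    Measurable[cylinderEvents s] f := by
  obtain ⟨g, rfl⟩ := dependsOn_iff_exists_comp.1 hf
  refine (measurable_of_countable g).comp ?_
  exact @measurable_pi_lambda _ _ _ (cylinderEvents s) _ _ fun e =>
    measurable_cylinderEvent_apply (hB e.2)

theorem dependsOn_indicator_avoiding (A : Set G.edgeSet) :
    DependsOn ((avoiding A).indicator (1 : Config G → ℝ)) A := by
  intro σ τ h
  have hiff : σ ∈ avoiding A ↔ τ ∈ avoiding A := forall₂_congr fun e he => by rw [h e he]
  classical simp only [Set.indicator_apply, hiff, Pi.one_apply]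

theorem dependsOn_indicator_agreeing (F S : Finset G.edgeSet) :
    DependsOn ((agreeing F S).indicator (1 : Config G → ℝ)) (F : Set G.edgeSet) := by
  intro σ τ h
  have hiff : σ ∈ agreeing F S ↔ τ ∈ agreeing F S := forall₂_congr fun e he => by rw [h e he]
  classical simp only [Set.indicator_apply, hiff, Pi.one_apply]

theorem exists_dependsOn_finiteGibbs [G.LocallyFinite] {F S : Finset G.edgeSet} (hS : S ⊆ F) :
    ∃ B : Finset G.edgeSet, (B : Set G.edgeSet) ⊆ (F : Set G.edgeSet)ᶜ ∧
      DependsOn (finiteGibbs G lam F S) (B : Set G.edgeSet) := by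
  obtain ⟨C, hC⟩ := exists_finset_edgesMeeting_subset F
  refine ⟨deleteEdges C F, fun e he => (mem_deleteEdges.1 he).2, fun σ τ h => ?_⟩
  exact finiteGibbs_congr hS fun e he e' he' he'F => h e' (mem_deleteEdges.2 ⟨hC e he he', he'F⟩)

theorem finiteGibbs_mem_Icc (hlam : 0 ≤ lam) {F S : Finset G.edgeSet} (hS : S ⊆ F)
    (σ : Config G) : finiteGibbs G lam F S σ ∈ Set.Icc 0 1 := by
  have hnonneg : 0 ≤ ∑ T ∈ F.powerset, weight G lam F T σ :=
    Finset.sum_nonneg fun T _ => weight_nonneg hlam F T σ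
  exact ⟨div_nonneg (weight_nonneg hlam F S σ) hnonneg, div_le_one_of_le₀
    (Finset.single_le_sum (fun T _ => weight_nonneg hlam F T σ) (Finset.mem_powerset.2 hS)) hnonneg⟩

theorem integral_finiteMeasure_finiteGibbs [Countable G.edgeSet] [G.LocallyFinite]
    (hlam : 0 ≤ lam) {F F' S : Finset G.edgeSet} (hF : F ⊆ F') (hS : S ⊆ F) {A : Finset G.edgeSet}
    (hA : (A : Set G.edgeSet) ⊆ (F : Set G.edgeSet)ᶜ) :
    ∫ σ, (avoiding (A : Set G.edgeSet)).indicator 1 σ * finiteGibbs G lam F S σ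
        ∂finiteMeasure G lam F' =
      ∫ σ, (avoiding (A : Set G.edgeSet)).indicator 1 σ * (agreeing F S).indicator 1 σ
        ∂finiteMeasure G lam F' := by
  classical
  obtain ⟨B, -, hB⟩ := exists_dependsOn_finiteGibbs (lam := lam) hS
  have havoid := continuous_of_dependsOn (dependsOn_indicator_avoiding (A : Set G.edgeSet))
  have hagree := continuous_of_dependsOn (dependsOn_indicator_agreeing F S)
  refine (integral_finiteMeasure hlam F'
    (havoid.mul (continuous_of_dependsOn hB)).stronglyMeasurable |>.trans ?_).trans
    (integral_finiteMeasure hlam F' (havoid.mul hagree).stronglyMeasurable).symm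
  have havoid_sdiff (M : Finset G.edgeSet) :
      (avoiding (A : Set G.edgeSet)).indicator (1 : Config G → ℝ) (configOf (M \ F)) =
        (avoiding (A : Set G.edgeSet)).indicator 1 (configOf M) :=
    dependsOn_indicator_avoiding _ fun _ he => configOf_sdiff_apply (hA he)
  have hagreeing (M : Finset G.edgeSet) :
      (agreeing F S).indicator (1 : Config G → ℝ) (configOf M) = if M ∩ F = S then 1 else 0 := by
    simp only [Set.indicator_apply, configOf_mem_agreeing hS, Pi.one_apply]
  have hmarkov := sum_matchingWeight_mul_finiteGibbs hlam hF hS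
    fun R => (avoiding (A : Set G.edgeSet)).indicator 1 (configOf R)
  simp only [havoid_sdiff, ← hagreeing] at hmarkov
  exact congrArg (· / matchingSum G lam F') hmarkov

theorem exists_setIntegral_avoiding_eq [Countable G.edgeSet] [G.LocallyFinite] (hlam : 0 ≤ lam) :
    ∃ μ : Measure (Config G), IsProbabilityMeasure μ ∧ ∀ F S A : Finset G.edgeSet, S ⊆ F →
      (A : Set G.edgeSet) ⊆ (F : Set G.edgeSet)ᶜ →
        ∫ σ in avoiding (A : Set G.edgeSet), finiteGibbs G lam F S σ ∂μ =
          ∫ σ in avoiding (A : Set G.edgeSet), (agreeing F S).indicator 1 σ ∂μ := by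
  obtain ⟨μ, hμ⟩ := exists_probabilityMeasure_integral_eq atTop fun F =>
    (⟨finiteMeasure G lam F, isProbabilityMeasure_finiteMeasure hlam F⟩ :
      ProbabilityMeasure (Config G))
  refine ⟨μ, inferInstance, fun F S A hS hA => ?_⟩
  obtain ⟨B, -, hB⟩ := exists_dependsOn_finiteGibbs (lam := lam) hS
  have havoid := continuous_of_dependsOn (dependsOn_indicator_avoiding (A : Set G.edgeSet))
  have hlimit := hμ _ _ (havoid.mul (continuous_of_dependsOn hB))
    (havoid.mul (continuous_of_dependsOn (dependsOn_indicator_agreeing F S)))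
    ((eventually_ge_atTop F).mono fun F' hF' =>
      integral_finiteMeasure_finiteGibbs hlam hF' hS hA)
  have hset (f : Config G → ℝ) :
      ∫ σ, ((avoiding (A : Set G.edgeSet)).indicator (1 : Config G → ℝ) * f) σ
          ∂(μ : Measure (Config G)) =
        ∫ σ in avoiding (A : Set G.edgeSet), f σ ∂(μ : Measure (Config G)) := by
    classical
    simp only [← integral_indicator (measurableSet_avoiding A.countable_toSet), Pi.mul_apply,
      Set.indicator_apply, Pi.one_apply, ite_mul, one_mul, zero_mul]
  rwa [hset, hset] at hlimit

theorem exists_isGibbsMeasure [Countable G.edgeSet] [G.LocallyFinite] (hlam : 0 ≤ lam) :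
    ∃ μ : Measure (Config G), IsGibbsMeasure G lam μ := by
  obtain ⟨μ, hprob, hμ⟩ := exists_setIntegral_avoiding_eq (G := G) hlam
  refine ⟨μ, hprob, fun F S hS => ?_⟩
  obtain ⟨B, hBF, hB⟩ := exists_dependsOn_finiteGibbs (lam := lam) hS
  have hmeas := measurable_cylinderEvents_of_dependsOn hB hBF
  have hle := cylinderEvents_le_pi (X := fun _ : G.edgeSet => Bool) (Δ := (F : Set G.edgeSet)ᶜ)
  have hgibbs : Integrable (finiteGibbs G lam F S) μ := by
    refine Integrable.of_bound (hmeas.mono hle le_rfl).aestronglyMeasurable 1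
      (ae_of_all _ fun σ => ?_)
    have hmem := finiteGibbs_mem_Icc hlam hS σ
    exact (Real.norm_of_nonneg hmem.1).trans_le hmem.2
  have hagree : Integrable ((agreeing F S).indicator fun _ => (1 : ℝ)) μ :=
    (integrable_const 1).indicator (measurableSet_agreeing F S)
  have hgen : ∀ s ∈ avoiding '' {A : Set G.edgeSet | A.Finite ∧ A ⊆ (F : Set G.edgeSet)ᶜ},
      ∫ σ in s, finiteGibbs G lam F S σ ∂μ =
        ∫ σ in s, (agreeing F S).indicator (fun _ => (1 : ℝ)) σ ∂μ := by
    rintro _ ⟨A, ⟨hA, hAF⟩, rfl⟩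
    lift A to Finset G.edgeSet using hA
    exact hμ F S A hS hAF
  have huniv : Set.univ ∈ avoiding '' {A : Set G.edgeSet | A.Finite ∧ A ⊆ (F : Set G.edgeSet)ᶜ} :=
    ⟨∅, ⟨Set.finite_empty, Set.empty_subset _⟩, by simp [avoiding]⟩
  exact (ae_eq_condExp_of_forall_setIntegral_eq hle hagree (fun s _ _ => hgibbs.integrableOn)
    (fun s hs _ => setIntegral_eq_setIntegral_of_isPiSystem hle
      (cylinderEvents_eq_generateFrom_avoiding _) (isPiSystem_avoiding _) huniv hgibbs hagree
      hgen hs) hmeas.stronglyMeasurable.aestronglyMeasurable).symm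

theorem existsUnique_isGibbsMeasure [Countable G.edgeSet] [G.LocallyFinite] {Δ : ℕ}
    (hΔ : ∀ v, G.degree v ≤ Δ) (hlam : 0 ≤ lam) :
    ∃! μ : Measure (Config G), IsGibbsMeasure G lam μ :=
  existsUnique_of_exists_of_unique (exists_isGibbsMeasure hlam)
    fun _ _ hμ hν => hμ.unique hΔ hlam hν

end Existence

section Embedding

variable {V W : Type*} {G : SimpleGraph V} {H : SimpleGraph W} {lam : ℝ}

/-- The map on edges induced by a graph embedding. -/
def edgeEmb (f : G ↪g H) : G.lineGraph ↪g H.lineGraph := f.toCopy.toLineGraphEmbedding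

theorem coe_edgeEmb (f : G ↪g H) (e : G.edgeSet) :
    (edgeEmb f e : Sym2 W) = (e : Sym2 V).map f := rfl

theorem edgeEmb_mem_edgesAt (f : G ↪g H) (e : G.edgeSet) (v : V) :
    edgeEmb f e ∈ edgesAt H (f v) ↔ e ∈ edgesAt G v := by
  simp only [edgesAt, Set.mem_ofPred_eq, coe_edgeEmb, Sym2.mem_map, f.injective.eq_iff,
    exists_eq_right]

theorem matchingWeight_map (f : G ↪g H) (S : Finset G.edgeSet) :
    matchingWeight H lam (S.map (edgeEmb f).toEmbedding) = matchingWeight G lam S := by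
  have hiff : IsMatching H (S.map (edgeEmb f).toEmbedding : Set H.edgeSet) ↔
      IsMatching G (S : Set G.edgeSet) := by
    simp only [IsMatching, Finset.coe_map, Set.forall_mem_image, RelEmbedding.coe_toEmbedding,
      SimpleGraph.Embedding.map_adj_iff]
  classical simp only [matchingWeight, hiff, Finset.card_map]

theorem matchingSum_map (f : G ↪g H) (F : Finset G.edgeSet) :
    matchingSum H lam (F.map (edgeEmb f).toEmbedding) = matchingSum G lam F := by
  classical
  rw [matchingSum, matchingSum, Finset.map_eq_image, Finset.powerset_image,
    Finset.sum_image (Finset.image_injective (edgeEmb f).toEmbedding.injective).injOn]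
  refine Finset.sum_congr rfl fun S _ => ?_
  rw [← matchingWeight_map f S, Finset.map_eq_image]

theorem vacancy_map (f : G ↪g H) (F : Finset G.edgeSet) (v : V) :
    vacancy H lam (F.map (edgeEmb f).toEmbedding) (f v) = vacancy G lam F v := by
  have hdelete : deleteEdges (F.map (edgeEmb f).toEmbedding) (edgesAt H (f v)) =
      (deleteEdges F (edgesAt G v)).map (edgeEmb f).toEmbedding := by
    ext e
    simp only [mem_deleteEdges, Finset.mem_map, RelEmbedding.coe_toEmbedding]
    constructor
    · rintro ⟨⟨e, he, rfl⟩, hv⟩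
      exact ⟨e, ⟨he, mt (edgeEmb_mem_edgesAt f e v).2 hv⟩, rfl⟩
    · rintro ⟨e, ⟨he, hv⟩, rfl⟩
      exact ⟨⟨e, he, rfl⟩, mt (edgeEmb_mem_edgesAt f e v).1 hv⟩
  rw [vacancy, avoidance, hdelete, matchingSum_map, matchingSum_map, vacancy, avoidance]

/-- The edges of `G` whose images under `f` have both ends in the finite set `A` of nodes. -/
noncomputable def edgesInto (f : G ↪g H) (A : Finset W) : Finset G.edgeSet :=
  A.sym2.preimage (fun e => (e : Sym2 V).map f)
    ((Sym2.map.injective f.injective).comp Subtype.val_injective).injOn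

theorem mem_edgesInto {f : G ↪g H} {A : Finset W} {e : G.edgeSet} :
    e ∈ edgesInto f A ↔ ∀ v ∈ (e : Sym2 V), f v ∈ A := by
  simp only [edgesInto, Finset.mem_preimage, Finset.mem_sym2_iff, Sym2.mem_map,
    forall_exists_index, and_imp, forall_apply_eq_imp_iff₂]

/-- The edges of `H` with both ends in the finite set `A` of nodes. -/
noncomputable def edgesIn (H : SimpleGraph W) (A : Finset W) : Finset H.edgeSet :=
  edgesInto (SimpleGraph.Embedding.refl : H ↪g H) A

theorem mem_edgesIn {A : Finset W} {e : H.edgeSet} :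
    e ∈ edgesIn H A ↔ ∀ w ∈ (e : Sym2 W), w ∈ A := mem_edgesInto

theorem map_edgesInto (f : G ↪g H) {A B : Finset W}
    (hB : ∀ w, w ∈ B ↔ w ∈ A ∧ w ∈ Set.range f) :
    (edgesInto f A).map (edgeEmb f).toEmbedding = edgesIn H B := by
  ext e
  simp only [Finset.mem_map, mem_edgesInto, mem_edgesIn, hB]
  constructor
  · rintro ⟨e, he, rfl⟩ w hw
    obtain ⟨a, ha, rfl⟩ := Sym2.mem_map.1 hw
    exact ⟨he a ha, a, rfl⟩
  · intro he
    obtain ⟨⟨a, b⟩, hab⟩ := e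
    obtain ⟨ha, a, rfl⟩ := he a (Sym2.mem_mk_left a b)
    obtain ⟨hb, b, rfl⟩ := he _ (Sym2.mem_mk_right _ b)
    exact ⟨⟨s(a, b), f.map_adj_iff.1 hab⟩, by simp [ha, hb], rfl⟩

theorem partitionFunction_induce (A : Finset W) :
    partitionFunction (H.induce (A : Set W)) lam = matchingSum H lam (edgesIn H A) := by
  have hmap := map_edgesInto (SimpleGraph.Embedding.induce (G := H) (A : Set W)) (A := A) (B := A)
    fun w => ⟨fun hw => ⟨hw, ⟨w, hw⟩, rfl⟩, And.left⟩
  rw [← hmap, matchingSum_map, matchingSum, partitionFunction]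
  refine Finset.sum_congr ?_ fun _ _ => rfl
  ext S
  simp only [Finset.mem_univ, Finset.mem_powerset, true_iff]
  exact fun e _ => mem_edgesInto.2 fun v _ => v.2

theorem edgesIn_eq_empty {A : Finset W} (hA : H.IsIndepSet (A : Set W)) : edgesIn H A = ∅ := by
  refine Finset.eq_empty_of_forall_notMem ?_
  rintro ⟨⟨u, v⟩, huv⟩ h
  rw [mem_edgesIn] at h
  exact hA (h u (Sym2.mem_mk_left u v)) (h v (Sym2.mem_mk_right u v)) huv.ne huv

theorem deleteEdges_edgesIn_insert [DecidableEq W] {A : Finset W} {a : W} (ha : a ∉ A) :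
    deleteEdges (edgesIn H (insert a A)) (edgesAt H a) = edgesIn H A := by
  ext e
  simp only [mem_deleteEdges, mem_edgesIn, Finset.mem_insert, edgesAt, Set.mem_ofPred_eq]
  constructor
  · rintro ⟨h, hae⟩ w hw
    exact (h w hw).resolve_left fun hwa => hae (hwa ▸ hw)
  · exact fun h => ⟨fun w hw => Or.inr (h w hw), fun hae => ha (h a hae)⟩

theorem log_vacancy_edgesIn_insert [DecidableEq W] (hlam : 0 ≤ lam) {A : Finset W} {a : W}
    (ha : a ∉ A) : Real.log (vacancy H lam (edgesIn H (insert a A)) a) =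
      Real.log (matchingSum H lam (edgesIn H A)) -
        Real.log (matchingSum H lam (edgesIn H (insert a A))) := by
  rw [vacancy, avoidance, deleteEdges_edgesIn_insert ha,
    Real.log_div (matchingSum_pos hlam _).ne' (matchingSum_pos hlam _).ne']

/-- The nodes of `X` are removed one by one, in decreasing order of `g`. -/
theorem log_matchingSum_union [DecidableEq W] (hlam : 0 ≤ lam) {β : Type*} [LinearOrder β]
    {g : W → β} (hg : Function.Injective g) {O X : Finset W} (hOX : Disjoint O X) :
    Real.log (matchingSum H lam (edgesIn H (O ∪ X))) =
      Real.log (matchingSum H lam (edgesIn H O)) - ∑ v ∈ X,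
        Real.log (vacancy H lam (edgesIn H (O ∪ X.filter fun u => g u ≤ g v)) v) := by
  induction X using Finset.induction_on_max_value g with
  | empty => simp only [Finset.union_empty, Finset.sum_empty, sub_zero]
  | insert a X haX ha ih =>
    rw [Finset.disjoint_insert_right] at hOX
    have hfilter_insert : (insert a X).filter (fun u => g u ≤ g a) = insert a X :=
      Finset.filter_true_of_mem (Finset.forall_mem_insert _ _ _ |>.2 ⟨le_rfl, ha⟩)
    have hfilter : ∀ v ∈ X, (insert a X).filter (fun u => g u ≤ g v) =
        X.filter fun u => g u ≤ g v := by
      intro v hv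
      have hav : ¬ g a ≤ g v := fun hav => haX (hg (hav.antisymm (ha v hv)) ▸ hv)
      rw [Finset.filter_insert, if_neg hav]
    rw [Finset.sum_insert haX, hfilter_insert,
      Finset.sum_congr rfl fun v hv => by rw [hfilter v hv], Finset.union_insert,
      log_vacancy_edgesIn_insert hlam (Finset.notMem_union.2 ⟨hOX.1, haX⟩), ih hOX.2]
    ring

end Embedding

section Averaging

variable {E : Type*} [AddCommGroup E] [DecidableEq E]

/-- The points of the finite set `A` that leave `A` under translation by `w`. -/
def exits (A : Finset E) (w : E) : Finset E := A.filter fun v => v + w ∉ A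

theorem mem_exits {A : Finset E} {v w : E} : v ∈ exits A w ↔ v ∈ A ∧ v + w ∉ A :=
  Finset.mem_filter

theorem exits_zero (A : Finset E) : exits A 0 = ∅ :=
  Finset.filter_false_of_mem fun v hv => by rwa [add_zero, not_not]

theorem card_exits_add_le (A : Finset E) (x y : E) :
    (exits A (x + y)).card ≤ (exits A x).card + (exits A y).card := by
  have hsub : exits A (x + y) ⊆ exits A x ∪ (exits A y).image (· - x) := by
    intro v hv
    rw [mem_exits, ← add_assoc] at hv
    rw [Finset.mem_union, mem_exits, Finset.mem_image]
    by_cases hx : v + x ∈ A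
    · exact Or.inr ⟨v + x, mem_exits.2 ⟨hx, hv.2⟩, add_sub_cancel_right v x⟩
    · exact Or.inl ⟨hv.1, hx⟩
  exact (Finset.card_le_card hsub).trans <| (Finset.card_union_le _ _).trans <|
    Nat.add_le_add_left Finset.card_image_le _

theorem card_filter_le_card_filter_add_card_exits (A : Finset E) {w : E} {p q : E → Prop}
    [DecidablePred p] [DecidablePred q] (hpq : ∀ v, p v → q (v + w)) :
    (A.filter p).card ≤ (A.filter q).card + (exits A w).card := by
  have hsub : A.filter p ⊆ ((A.filter q).image (· - w)) ∪ exits A w := by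
    intro v hv
    rw [Finset.mem_filter] at hv
    rw [Finset.mem_union, mem_exits, Finset.mem_image]
    by_cases hw : v + w ∈ A
    · exact Or.inl ⟨v + w, Finset.mem_filter.2 ⟨hw, hpq v hv.2⟩, add_sub_cancel_right v w⟩
    · exact Or.inr ⟨hv.1, hw⟩
  exact (Finset.card_le_card hsub).trans <| (Finset.card_union_le _ _).trans <|
    Nat.add_le_add_right Finset.card_image_le _

theorem sum_card_filter_add_notMem_le {A X : Finset E} (hXA : X ⊆ A) (W : Finset E) :
    ∑ v ∈ X, (W.filter fun w => v + w ∉ A).card ≤ ∑ w ∈ W, (exits A w).card :=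
  (Finset.sum_card_bipartiteAbove_eq_sum_card_bipartiteBelow fun v w => v + w ∉ A).trans_le <|
    Finset.sum_le_sum fun _ _ => Finset.card_le_card (Finset.filter_subset_filter _ hXA)

theorem abs_sum_sub_le {A X : Finset E} (hXA : X ⊆ A) (W : Finset E) {φ : E → ℝ} {L ε C : ℝ}
    (hε : 0 ≤ ε) (hC : 0 ≤ C) (hbound : ∀ v ∈ X, |φ v - L| ≤ C)
    (hlocal : ∀ v ∈ X, (∀ w ∈ W, v + w ∈ A) → |φ v - L| ≤ ε) :
    |∑ v ∈ X, (φ v - L)| ≤ A.card * ε + C * ∑ w ∈ W, ((exits A w).card : ℝ) := by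
  have hterm : ∀ v ∈ X, |φ v - L| ≤ ε + C * (W.filter fun w => v + w ∉ A).card := by
    intro v hv
    by_cases hvW : ∀ w ∈ W, v + w ∈ A
    · exact (hlocal v hv hvW).trans (le_add_of_nonneg_right (by positivity))
    · push Not at hvW
      have hcard : 1 ≤ ((W.filter fun w => v + w ∉ A).card : ℝ) := by
        exact_mod_cast Finset.card_pos.2 (hvW.imp fun w hw => Finset.mem_filter.2 hw)
      exact (hbound v hv).trans <| (le_mul_of_one_le_right hC hcard).trans
        (le_add_of_nonneg_left hε)
  calc |∑ v ∈ X, (φ v - L)|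
      ≤ ∑ v ∈ X, (ε + C * (W.filter fun w => v + w ∉ A).card) :=
        (Finset.abs_sum_le_sum_abs _ _).trans (Finset.sum_le_sum hterm)
    _ = X.card * ε + C * (∑ v ∈ X, (W.filter fun w => v + w ∉ A).card : ℕ) := by
        rw [Finset.sum_add_distrib, Finset.sum_const, nsmul_eq_mul, ← Finset.mul_sum, Nat.cast_sum]
    _ ≤ A.card * ε + C * (∑ w ∈ W, (exits A w).card : ℕ) := by
        gcongr
        exact sum_card_filter_add_notMem_le hXA W
    _ = A.card * ε + C * ∑ w ∈ W, ((exits A w).card : ℝ) := by rw [Nat.cast_sum]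

theorem tendsto_sum_div_card {ι : Type*} {l : Filter ι} {Λ X : ι → Finset E} {φ : ι → E → ℝ}
    {L C α : ℝ} (hX : ∀ i, X i ⊆ Λ i)
    (hα : Tendsto (fun i => ((X i).card : ℝ) / (Λ i).card) l (𝓝 α))
    (hexits : ∀ w, Tendsto (fun i => ((exits (Λ i) w).card : ℝ) / (Λ i).card) l (𝓝 0))
    (hC : 0 ≤ C) (hbound : ∀ i, ∀ v ∈ X i, |φ i v - L| ≤ C)
    (hlocal : ∀ ε > 0, ∃ W : Finset E, ∀ i, ∀ v ∈ X i, (∀ w ∈ W, v + w ∈ Λ i) → |φ i v - L| ≤ ε) :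
    Tendsto (fun i => (∑ v ∈ X i, φ i v) / (Λ i).card) l (𝓝 (α * L)) := by
  suffices hzero : Tendsto (fun i => (∑ v ∈ X i, (φ i v - L)) / (Λ i).card) l (𝓝 0) by
    have hadd := hzero.add (hα.mul_const L)
    rw [zero_add] at hadd
    refine hadd.congr fun i => ?_
    rw [Finset.sum_sub_distrib, Finset.sum_const, nsmul_eq_mul]
    ring
  rw [Metric.tendsto_nhds]
  intro ε hε
  obtain ⟨W, hW⟩ := hlocal (ε / 2) (half_pos hε)
  have hfew : Tendsto (fun i => C * ∑ w ∈ W, ((exits (Λ i) w).card : ℝ) / (Λ i).card) l (𝓝 0) := by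
    simpa only [Finset.sum_const_zero, mul_zero] using
      (tendsto_finsetSum W fun w _ => hexits w).const_mul C
  filter_upwards [hfew.eventually_lt_const (half_pos hε)] with i hi
  rw [Real.dist_0_eq_abs, abs_div, Nat.abs_cast]
  calc |∑ v ∈ X i, (φ i v - L)| / (Λ i).card
      ≤ ((Λ i).card * (ε / 2) + C * ∑ w ∈ W, ((exits (Λ i) w).card : ℝ)) / (Λ i).card := by
        gcongr
        exact abs_sum_sub_le (hX i) W (half_pos hε).le hC (hbound i) (hW i)
    _ = (Λ i).card * (ε / 2) / (Λ i).card +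
          C * ∑ w ∈ W, ((exits (Λ i) w).card : ℝ) / (Λ i).card := by
        rw [add_div, mul_div_assoc C, Finset.sum_div]
    _ < ε / 2 + ε / 2 := add_lt_add_of_le_of_lt
        (div_le_of_le_mul₀ (Nat.cast_nonneg _) (half_pos hε).le (mul_comm _ _).le) hi
    _ = ε := add_halves ε

end Averaging

section Lattice

variable {d : ℕ}

theorem abs_apply_le_l1norm (v : Fin d → ℤ) (j : Fin d) : |v j| ≤ l1norm v :=
  Finset.single_le_sum (f := fun j => |v j|) (fun _ _ => abs_nonneg _) (Finset.mem_univ j)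

theorem l1norm_single (j : Fin d) (a : ℤ) : l1norm (Pi.single j a) = |a| := by
  simp only [l1norm, Pi.single_apply, apply_ite, abs_zero, Finset.sum_ite_eq', Finset.mem_univ,
    if_true]

/-- The box `[-n, n]^d`. -/
noncomputable def box (d n : ℕ) : Finset (Fin d → ℤ) :=
  Finset.Icc (fun _ => -(n : ℤ)) fun _ => (n : ℤ)

theorem mem_box {n : ℕ} {v : Fin d → ℤ} : v ∈ box d n ↔ ∀ j, |v j| ≤ n := by
  simp only [box, Finset.mem_Icc, Pi.le_def, abs_le, forall_and]

theorem mem_box_of_l1norm_le {n : ℕ} {v : Fin d → ℤ} (hv : l1norm v ≤ n) : v ∈ box d n :=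
  mem_box.2 fun j => (abs_apply_le_l1norm v j).trans hv

theorem card_box (d n : ℕ) : (box d n).card = (2 * n + 1) ^ d := by
  rw [box, Pi.card_Icc]
  simp only [Int.card_Icc, Finset.prod_const, Finset.card_univ, Fintype.card_fin]
  congr 1
  lia

theorem box_mono : Monotone (box d) := fun _ _ hmn _ hv =>
  mem_box.2 fun j => (mem_box.1 hv j).trans (Nat.cast_le.2 hmn)

/-- The displacement to a neighbour of `v` in an induced subgraph of the lattice. -/
noncomputable def displacement {R : Set (Fin d → ℤ)} (v : R) :
    ((lattice d).induce R).neighborSet v ↪ box d 1 where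
  toFun u := ⟨u - v, mem_box_of_l1norm_le u.2.le⟩
  inj' _ _ huw := Subtype.ext (Subtype.ext (sub_left_injective (congrArg Subtype.val huw)))

noncomputable instance (R : Set (Fin d → ℤ)) : ((lattice d).induce R).LocallyFinite :=
  fun v => Fintype.ofInjective (displacement v) (displacement v).injective

theorem degree_induce_lattice_le (R : Set (Fin d → ℤ)) (v : R) :
    ((lattice d).induce R).degree v ≤ 3 ^ d := by
  rw [← SimpleGraph.card_neighborSet_eq_degree]
  exact (Fintype.card_le_of_embedding (displacement v)).trans_eq <|
    (Fintype.card_coe _).trans (card_box d 1)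

theorem even_l1norm_add_sum (v : Fin d → ℤ) : Even (l1norm v + ∑ j, v j) := by
  rw [l1norm, ← Finset.sum_add_distrib]
  refine Finset.even_sum _ fun j _ => ?_
  rw [Int.even_add, even_abs]

theorem isIndepSet_not_even_sum :
    (lattice d).IsIndepSet {v | ¬ Even (∑ j, v j)} := by
  intro u hu v hv _ huv
  have heven := even_l1norm_add_sum (v - u)
  rw [show l1norm (v - u) = 1 from huv] at heven
  simp only [Pi.sub_apply, Finset.sum_sub_distrib] at heven
  rw [Set.mem_ofPred_eq, Int.not_even_iff_odd] at hu hv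
  exact Int.not_even_iff_odd.2 odd_one ((Int.even_add.1 heven).2 (hv.sub_odd hu))

/-- The translation by `v`, as an embedding of an induced subgraph into the lattice. -/
def translation (R : Set (Fin d → ℤ)) (v : Fin d → ℤ) : (lattice d).induce R ↪g lattice d where
  toFun x := x + v
  inj' _ _ hxy := Subtype.ext (add_right_cancel hxy)
  map_rel_iff' {x y} := by
    change l1norm ((y.1 + v) - (x.1 + v)) = 1 ↔ l1norm (y.1 - x.1) = 1
    rw [add_sub_add_right_eq_sub]

theorem translation_apply (R : Set (Fin d → ℤ)) (v : Fin d → ℤ) (x : R) :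
    translation R v x = x + v := rfl

theorem mem_range_translation {R : Set (Fin d → ℤ)} {u v : Fin d → ℤ} :
    u ∈ Set.range (translation R v) ↔ u - v ∈ R :=
  ⟨fun ⟨x, hx⟩ => by rw [← hx, translation_apply, add_sub_cancel_right]; exact x.2,
    fun huv => ⟨⟨u - v, huv⟩, sub_add_cancel u v⟩⟩

theorem prec_sub {u v w : Fin d → ℤ} : Prec (u - w) (v - w) ↔ Prec u v := by
  simp only [Prec, Pi.sub_apply, sub_lt_sub_iff_right, sub_left_inj]

theorem prec_iff_toColex_lt {u v : Fin d → ℤ} : Prec u v ↔ toColex u < toColex v :=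
  exists_congr fun _ => and_comm

theorem sub_mem_below {u v : Fin d → ℤ} : u - v ∈ below d ↔ toColex u ≤ toColex v := by
  have hprec : Prec (u - v) 0 ↔ Prec u v := by rw [← sub_self v, prec_sub]
  rw [below, Set.mem_union, Set.mem_ofPred_eq, Set.mem_singleton_iff, sub_eq_zero, hprec,
    prec_iff_toColex_lt, ← toColex_inj]
  exact le_iff_lt_or_eq.symm

theorem sub_mem_belowEven {u v : Fin d → ℤ} (hv : Even (∑ j, v j)) :
    u - v ∈ belowEven d ↔ ¬ Even (∑ j, u j) ∨ toColex u ≤ toColex v := by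
  have hprec : Prec 0 (u - v) ↔ Prec v u := by rw [← sub_self v, prec_sub]
  have hodd : Odd (∑ j, (u - v) j) ↔ ¬ Even (∑ j, u j) := by
    simp only [Pi.sub_apply, Finset.sum_sub_distrib, Int.odd_sub, hv, iff_true,
      Int.not_even_iff_odd]
  rw [belowEven, Set.mem_union, sub_mem_below, Set.mem_ofPred_eq, hodd, hprec,
    prec_iff_toColex_lt, or_comm]
  have hlt : toColex v < toColex u ↔ ¬ toColex u ≤ toColex v := not_le.symm
  tauto

end Lattice

section Exhaustion

variable {d : ℕ} {Λ : ℕ → Finset (Fin d → ℤ)}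

theorem IsExhaustion.card_pos (hΛ : IsExhaustion Λ) (n : ℕ) : 0 < (Λ n).card :=
  Finset.card_pos.2 ⟨0, hΛ.mono (Nat.zero_le n) hΛ.zero_mem⟩

theorem card_exits_le_ncard_boundary (A : Finset (Fin d → ℤ)) {w : Fin d → ℤ}
    (hw : l1norm w = 1) : (exits A w).card ≤ (boundary A).ncard := by
  rw [← Set.ncard_coe_finset]
  refine Set.ncard_le_ncard (fun v hv => ?_) (A.finite_toSet.subset fun _ hv => hv.1)
  obtain ⟨hvA, hvw⟩ := mem_exits.1 hv
  exact ⟨hvA, v + w, (congrArg l1norm (add_sub_cancel_left v w)).trans hw, hvw⟩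

theorem tendsto_card_exits_add {x y : Fin d → ℤ}
    (hx : Tendsto (fun n => ((exits (Λ n) x).card : ℝ) / (Λ n).card) atTop (𝓝 0))
    (hy : Tendsto (fun n => ((exits (Λ n) y).card : ℝ) / (Λ n).card) atTop (𝓝 0)) :
    Tendsto (fun n => ((exits (Λ n) (x + y)).card : ℝ) / (Λ n).card) atTop (𝓝 0) := by
  have hadd := hx.add hy
  rw [add_zero] at hadd
  refine squeeze_zero (fun _ => by positivity) (fun n => ?_) hadd
  rw [← add_div]
  gcongr
  exact_mod_cast card_exits_add_le (Λ n) x y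

theorem IsExhaustion.tendsto_card_exits (hΛ : IsExhaustion Λ) (w : Fin d → ℤ) :
    Tendsto (fun n => ((exits (Λ n) w).card : ℝ) / (Λ n).card) atTop (𝓝 0) := by
  let negligible : AddSubmonoid (Fin d → ℤ) :=
    { carrier := {w | Tendsto (fun n => ((exits (Λ n) w).card : ℝ) / (Λ n).card) atTop (𝓝 0)}
      zero_mem' := by simp [exits_zero]
      add_mem' := tendsto_card_exits_add }
  have hunit : ∀ v : Fin d → ℤ, l1norm v = 1 → v ∈ negligible := fun v hv =>
    squeeze_zero (fun _ => by positivity)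
      (fun n => by gcongr; exact card_exits_le_ncard_boundary (Λ n) hv) hΛ.boundary_small
  have hsingle : ∀ (j : Fin d) (a : ℤ), Pi.single j a ∈ negligible := by
    intro j a
    induction a with
    | zero => simpa only [Pi.single_zero] using negligible.zero_mem
    | succ a ih =>
      rw [Pi.single_add]
      exact negligible.add_mem ih (hunit _ (by rw [l1norm_single, abs_one]))
    | pred a ih =>
      rw [sub_eq_add_neg, Pi.single_add]
      exact negligible.add_mem ih (hunit _ (by rw [l1norm_single, abs_neg, abs_one]))
  have hsum : ∑ j, Pi.single j (w j) ∈ negligible := sum_mem fun j _ => hsingle j (w j)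
  rwa [Finset.univ_sum_single] at hsum

/-- The unit translation in the first coordinate direction exchanges the two parities. -/
theorem IsExhaustion.tendsto_card_filter_even_sum (hΛ : IsExhaustion Λ) (hd : 0 < d) :
    Tendsto (fun n => (((Λ n).filter fun v => Even (∑ j, v j)).card : ℝ) / (Λ n).card) atTop
      (𝓝 (1 / 2)) := by
  set w : Fin d → ℤ := Pi.single ⟨0, hd⟩ 1
  have hflip : ∀ v : Fin d → ℤ, Even (∑ j, (v + w) j) ↔ ¬ Even (∑ j, v j) := by
    intro v
    simp only [Pi.add_apply, Finset.sum_add_distrib, w, Finset.sum_pi_single', Finset.mem_univ,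
      if_true, Int.even_add_one]
  rw [tendsto_iff_norm_sub_tendsto_zero]
  refine squeeze_zero (fun _ => norm_nonneg _) (fun n => ?_) (hΛ.tendsto_card_exits w)
  have hpos : (0 : ℝ) < (Λ n).card := Nat.cast_pos.2 (hΛ.card_pos n)
  have heven := card_filter_le_card_filter_add_card_exits (Λ n) (w := w)
    (p := fun v => Even (∑ j, v j)) (q := fun v => ¬ Even (∑ j, v j))
    fun v hv => by rwa [hflip, not_not]
  have hodd := card_filter_le_card_filter_add_card_exits (Λ n) (w := w)
    (p := fun v => ¬ Even (∑ j, v j)) (q := fun v => Even (∑ j, v j)) fun v => (hflip v).2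
  have htotal := Finset.card_filter_add_card_filter_not (s := Λ n) fun v => Even (∑ j, v j)
  rify at heven hodd htotal
  rw [Real.norm_eq_abs, div_sub' hpos.ne', abs_div, abs_of_pos hpos]
  gcongr
  rw [abs_le]
  constructor <;> linarith

theorem ncard_boundary_box_le (d n : ℕ) :
    (boundary (box d (n + 1))).ncard ≤ (box d (n + 1)).card - (box d n).card := by
  rw [← Finset.card_sdiff_of_subset (box_mono n.le_succ), ← Set.ncard_coe_finset]
  refine Set.ncard_le_ncard ?_ (Finset.finite_toSet _)
  rintro v ⟨hv, u, huv, hu⟩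
  refine Finset.mem_coe.2 (Finset.mem_sdiff.2 ⟨hv, fun hvn => hu (mem_box.2 fun j => ?_)⟩)
  calc |u j| ≤ |(u - v) j| + |v j| := by
        simpa only [Pi.sub_apply, sub_add_cancel] using abs_add_le (u j - v j) (v j)
    _ ≤ 1 + n := add_le_add ((abs_apply_le_l1norm _ j).trans_eq huv) (mem_box.1 hvn j)
    _ = (n + 1 : ℕ) := by push_cast; ring

theorem tendsto_boundary_box (d : ℕ) :
    Tendsto (fun n => ((boundary (box d n)).ncard : ℝ) / (box d n).card) atTop (𝓝 0) := by
  rw [← tendsto_add_atTop_iff_nat 1]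
  have hlim : Tendsto (fun n : ℕ => 1 - (1 - 2 / (2 * (n : ℝ) + 3)) ^ d) atTop (𝓝 0) := by
    have hsmall : Tendsto (fun n : ℕ => 2 / (2 * (n : ℝ) + 3)) atTop (𝓝 0) :=
      (tendsto_atTop_add_const_right _ _
        (tendsto_natCast_atTop_atTop.const_mul_atTop two_pos)).const_div_atTop 2
    simpa only [sub_zero, one_pow, sub_self] using ((hsmall.const_sub 1).pow d).const_sub 1
  refine squeeze_zero (fun n => by positivity) (fun n => ?_) hlim
  have hpos : (0 : ℝ) < 2 * n + 3 := by positivity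
  have hcard : ((box d (n + 1)).card : ℝ) = (2 * n + 3) ^ d := by
    rw [card_box]
    push_cast
    ring
  have hbound := (Nat.cast_le (α := ℝ)).2 (ncard_boundary_box_le d n)
  rw [Nat.cast_sub (Finset.card_le_card (box_mono n.le_succ)), hcard, card_box, Nat.cast_pow,
    Nat.cast_add, Nat.cast_mul, Nat.cast_ofNat, Nat.cast_one] at hbound
  rw [hcard, div_le_iff₀ (by positivity)]
  refine hbound.trans_eq ?_
  rw [sub_mul, one_mul, ← mul_pow, sub_mul, div_mul_cancel₀ _ hpos.ne']
  congr 2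
  ring

theorem isExhaustion_box (d : ℕ) : IsExhaustion (box d) where
  zero_mem := mem_box.2 fun _ => abs_zero.le
  mono := box_mono
  ball_subset r := (eventually_ge_atTop r).mono fun _ hn _ hv =>
    mem_box_of_l1norm_le (hv.trans (Nat.cast_le.2 hn))
  boundary_small := tendsto_boundary_box d

end Exhaustion

section FreeEnergy

section

variable {V : Type*} {G : SimpleGraph V} [G.LocallyFinite] {Δ : ℕ} {lam : ℝ}

theorem abs_log_vacancy_le (hΔ : ∀ v, G.degree v ≤ Δ) (hlam : 0 ≤ lam) (F : Finset G.edgeSet)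
    (v : V) : |Real.log (vacancy G lam F v)| ≤ Real.log (1 + lam * Δ) := by
  have hlower := inv_one_add_le_vacancy hΔ hlam F v
  have hpos : 0 < (1 + lam * Δ)⁻¹ := by positivity
  rw [abs_of_nonpos (Real.log_nonpos (hpos.le.trans hlower) (avoidance_le_one hlam F _)), neg_le,
    ← Real.log_inv]
  exact Real.log_le_log hpos hlower

theorem IsGibbsMeasure.exists_abs_log_vacancy_sub_le (hΔ : ∀ v, G.degree v ≤ Δ) (hlam : 0 ≤ lam)
    {μ : Measure (Config G)} (hμ : IsGibbsMeasure G lam μ) (v : V) {ε : ℝ} (hε : 0 < ε) :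
    ∃ B : Finset G.edgeSet, ∀ F, B ⊆ F →
      |Real.log (vacancy G lam F v) - Real.log (μ.real (unmatched G v))| ≤ ε := by
  have hlim := (hμ.tendsto_vacancy hΔ hlam v).log (hμ.measureReal_unmatched_pos hΔ hlam v).ne'
  classical
  obtain ⟨B, hB⟩ := eventually_atTop.1 (Metric.tendsto_nhds.1 hlim ε hε)
  exact ⟨B, fun F hF => ((Real.dist_eq _ _).symm.trans_lt (hB F hF)).le⟩

end

variable {d : ℕ} {lam : ℝ} {R : Set (Fin d → ℤ)} {Λ : ℕ → Finset (Fin d → ℤ)}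

theorem exists_subset_edgesInto_translation (B : Finset ((lattice d).induce R).edgeSet) :
    ∃ W : Finset (Fin d → ℤ), ∀ v A, (∀ w ∈ W, v + w ∈ A) →
      B ⊆ edgesInto (translation R v) A := by
  classical
  refine ⟨B.biUnion fun e => (e : Sym2 R).toFinset.image Subtype.val, fun v A hA e he => ?_⟩
  refine mem_edgesInto.2 fun x hx => ?_
  rw [translation_apply, add_comm]
  exact hA x (Finset.mem_biUnion.2 ⟨e, he, Finset.mem_image_of_mem _ (Sym2.mem_toFinset.2 hx)⟩)

theorem vacancy_edgesInto_translation (h0 : 0 ∈ R) {A B : Finset (Fin d → ℤ)} {v : Fin d → ℤ}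
    (hB : ∀ u, u ∈ B ↔ u ∈ A ∧ u - v ∈ R) :
    vacancy _ lam (edgesInto (translation R v) A) ⟨0, h0⟩ =
      vacancy (lattice d) lam (edgesIn _ B) v := by
  have hmap := map_edgesInto (translation R v) (A := A) (B := B) fun u => by
    rw [hB, mem_range_translation]
  rw [← vacancy_map (translation R v), hmap, translation_apply, zero_add]

theorem log_partitionFunction_eq_neg_sum (hlam : 0 ≤ lam) (h0 : 0 ∈ R)
    {p : (Fin d → ℤ) → Prop} [DecidablePred p]
    (hp : ∀ v, p v → ∀ u, u - v ∈ R ↔ ¬ p u ∨ toColex u ≤ toColex v)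
    (hindep : (lattice d).IsIndepSet {v | ¬ p v}) (A : Finset (Fin d → ℤ)) :
    Real.log (partitionFunction ((lattice d).induce (A : Set (Fin d → ℤ))) lam) =
      -∑ v ∈ A.filter p, Real.log (vacancy _ lam (edgesInto (translation R v) A) ⟨0, h0⟩) := by
  have hempty : edgesIn (lattice d) (A.filter fun v => ¬ p v) = ∅ :=
    edgesIn_eq_empty (hindep.mono fun v hv => (Finset.mem_filter.1 hv).2)
  have hunion := log_matchingSum_union (H := lattice d) hlam toColex.injective
    (Finset.disjoint_filter_filter_not A A p).symm
  rw [Finset.union_comm, Finset.filter_union_filter_not_eq, hempty, matchingSum_empty,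
    Real.log_one, zero_sub] at hunion
  rw [partitionFunction_induce, hunion, neg_inj]
  refine Finset.sum_congr rfl fun v hv => congrArg Real.log ?_
  refine (vacancy_edgesInto_translation h0 fun u => ?_).symm
  rw [hp v (Finset.mem_filter.1 hv).2]
  simp only [Finset.mem_union, Finset.mem_filter]
  tauto

theorem tendsto_log_partitionFunction (hlam : 0 ≤ lam) (h0 : 0 ∈ R)
    {μ : Measure (Config ((lattice d).induce R))} (hμ : IsGibbsMeasure _ lam μ)
    {p : (Fin d → ℤ) → Prop} [DecidablePred p]
    (hp : ∀ v, p v → ∀ u, u - v ∈ R ↔ ¬ p u ∨ toColex u ≤ toColex v)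
    (hindep : (lattice d).IsIndepSet {v | ¬ p v}) (hΛ : IsExhaustion Λ) {α : ℝ}
    (hα : Tendsto (fun n => (((Λ n).filter p).card : ℝ) / (Λ n).card) atTop (𝓝 α)) :
    Tendsto (fun n =>
      Real.log (partitionFunction ((lattice d).induce (Λ n : Set (Fin d → ℤ))) lam) / (Λ n).card)
      atTop (𝓝 (-(α * Real.log (μ.real (unmatched _ ⟨0, h0⟩))))) := by
  have hΔ := degree_induce_lattice_le R
  set L := Real.log (μ.real (unmatched _ ⟨0, h0⟩))
  have haverage : Tendsto (fun n => (∑ v ∈ (Λ n).filter p,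
      Real.log (vacancy _ lam (edgesInto (translation R v) (Λ n)) ⟨0, h0⟩)) / (Λ n).card) atTop
      (𝓝 (α * L)) := by
    refine tendsto_sum_div_card (C := Real.log (1 + lam * (3 ^ d : ℕ)) + |L|)
      (fun n => Finset.filter_subset _ _) hα hΛ.tendsto_card_exits
      (add_nonneg ((abs_nonneg _).trans (abs_log_vacancy_le hΔ hlam ∅ ⟨0, h0⟩)) (abs_nonneg _))
      (fun n v _ => (abs_sub _ _).trans (add_le_add_left (abs_log_vacancy_le hΔ hlam _ _) _))
      fun ε hε => ?_
    obtain ⟨B, hB⟩ := hμ.exists_abs_log_vacancy_sub_le hΔ hlam ⟨0, h0⟩ hε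
    obtain ⟨W, hW⟩ := exists_subset_edgesInto_translation B
    exact ⟨W, fun n v _ hv => hB _ (hW v (Λ n) hv)⟩
  refine haverage.neg.congr fun n => ?_
  rw [log_partitionFunction_eq_neg_sum hlam h0 hp hindep, neg_div]

theorem isFreeEnergy_below (hlam : 0 ≤ lam) {μ : Measure (Config ((lattice d).induce (below d)))}
    (hμ : IsGibbsMeasure _ lam μ) :
    IsFreeEnergy d lam (-Real.log (μ.real (unmatched _ ⟨0, zero_mem_below d⟩))) := by
  intro Λ hΛ
  have hα : Tendsto (fun n => (((Λ n).filter fun _ => True).card : ℝ) / (Λ n).card) atTop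
      (𝓝 1) := by
    refine tendsto_const_nhds.congr fun n => ?_
    rw [Finset.filter_true, div_self (Nat.cast_ne_zero.2 (hΛ.card_pos n).ne')]
  have hlim := tendsto_log_partitionFunction hlam (zero_mem_below d) hμ (p := fun _ => True)
    (fun v _ u => by rw [sub_mem_below, not_true, false_or]) (by simp) hΛ hα
  rwa [one_mul] at hlim

theorem isFreeEnergy_belowEven (hd : 0 < d) (hlam : 0 ≤ lam)
    {ν : Measure (Config ((lattice d).induce (belowEven d)))} (hν : IsGibbsMeasure _ lam ν) :
    IsFreeEnergy d lam (-(1 / 2 * Real.log (ν.real (unmatched _ ⟨0, zero_mem_belowEven d⟩)))) :=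
  fun _ hΛ => tendsto_log_partitionFunction hlam (zero_mem_belowEven d) hν
    (fun _ hv _ => sub_mem_belowEven hv) isIndepSet_not_even_sum hΛ
    (hΛ.tendsto_card_filter_even_sum hd)

theorem IsFreeEnergy.unique {P Q : ℝ} (hP : IsFreeEnergy d lam P) (hQ : IsFreeEnergy d lam Q) :
    P = Q :=
  tendsto_nhds_unique (hP _ (isExhaustion_box d)) (hQ _ (isExhaustion_box d))

theorem unmatched_eq_univ {V : Type*} [Subsingleton V] (G : SimpleGraph V) (v : V) :
    unmatched G v = Set.univ := by
  refine Set.eq_univ_of_forall fun σ e => ?_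
  obtain ⟨⟨a, b⟩, hab⟩ := e
  exact absurd (Subsingleton.elim a b) (SimpleGraph.Adj.ne hab)

theorem log_measureReal_unmatched_below_eq (hlam : 0 ≤ lam)
    {μ : Measure (Config ((lattice d).induce (below d)))} (hμ : IsGibbsMeasure _ lam μ)
    {ν : Measure (Config ((lattice d).induce (belowEven d)))} (hν : IsGibbsMeasure _ lam ν) :
    Real.log (μ.real (unmatched _ ⟨0, zero_mem_below d⟩)) =
      1 / 2 * Real.log (ν.real (unmatched _ ⟨0, zero_mem_belowEven d⟩)) := by
  rcases Nat.eq_zero_or_pos d with rfl | hd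
  · have := hμ.isProbabilityMeasure
    have := hν.isProbabilityMeasure
    rw [unmatched_eq_univ, unmatched_eq_univ, probReal_univ, probReal_univ, Real.log_one, mul_zero]
  · exact neg_injective ((isFreeEnergy_below hlam hμ).unique (isFreeEnergy_belowEven hd hlam hν))

theorem existsUnique_isGibbsMeasure_induce_lattice (hlam : 0 ≤ lam) (R : Set (Fin d → ℤ)) :
    ∃! μ : Measure (Config ((lattice d).induce R)), IsGibbsMeasure _ lam μ := by
  have : Countable (Sym2 R) := inferInstanceAs (Countable (Quot _))
  exact existsUnique_isGibbsMeasure (degree_induce_lattice_le R) hlam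

end FreeEnergy

end MonomerDimer

theorem corollary4 (d : ℕ) (lam : ℝ) (hlam : 0 < lam) :
    (∃! μ : Measure (MonomerDimer.Config
        ((MonomerDimer.lattice d).induce (MonomerDimer.below d))),
      MonomerDimer.IsGibbsMeasure _ lam μ) ∧
    (∃! ν : Measure (MonomerDimer.Config
        ((MonomerDimer.lattice d).induce (MonomerDimer.belowEven d))),
      MonomerDimer.IsGibbsMeasure _ lam ν) ∧
    ∀ (μ : Measure (MonomerDimer.Config
        ((MonomerDimer.lattice d).induce (MonomerDimer.below d))))
      (ν : Measure (MonomerDimer.Config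
        ((MonomerDimer.lattice d).induce (MonomerDimer.belowEven d)))),
      MonomerDimer.IsGibbsMeasure _ lam μ → MonomerDimer.IsGibbsMeasure _ lam ν →
      0 < μ.real (MonomerDimer.unmatched _ ⟨0, MonomerDimer.zero_mem_below d⟩) ∧
      0 < ν.real (MonomerDimer.unmatched _ ⟨0, MonomerDimer.zero_mem_belowEven d⟩) ∧
      ∃ P : ℝ, MonomerDimer.IsFreeEnergy d lam P ∧
        P = -Real.log
          (μ.real (MonomerDimer.unmatched _ ⟨0, MonomerDimer.zero_mem_below d⟩)) ∧
        P = -(1 / 2) * Real.log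
          (ν.real (MonomerDimer.unmatched _ ⟨0, MonomerDimer.zero_mem_belowEven d⟩)) := by
  open MonomerDimer in
  refine ⟨existsUnique_isGibbsMeasure_induce_lattice hlam.le _,
    existsUnique_isGibbsMeasure_induce_lattice hlam.le _, fun μ ν hμ hν => ?_⟩
  refine ⟨hμ.measureReal_unmatched_pos (degree_induce_lattice_le _) hlam.le _,
    hν.measureReal_unmatched_pos (degree_induce_lattice_le _) hlam.le _,
    _, isFreeEnergy_below hlam.le hμ, rfl, ?_⟩
  rw [log_measureReal_unmatched_below_eq hlam.le hμ hν, neg_mul]
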